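/- Fix an integer $m\ge 1$. The Barabási–Albert (BA) model $(G_m^t)_{t\ge1}$ is the random multigraph process that starts at time $t=1$ with a single vertex $v_1$ and no edge, and evolves as follows for every integer $n\ge 0$: at time $t=n(m+1)+1$ a new vertex $v_{n+1}$ is added, and at each time $t=n(m+1)+i$, $i=2,\dots,m+1$, an edge from $v_{n+1}$ to a vertex $v$ is added, where, conditionally on the past, $v$ is chosen with probability $$\frac{d(v,t-1)}{2(mn+i-1)-1}\ \text{ if } v\neq v_{n+1},\qquad \frac{d(v,t-1)+1}{2(mn+i-1)-1}\ \text{ if } v=v_{n+1},$$ $d(v,t)$ being the degree of $v$ in $G_m^t$ (a loop counts twice). Let $N_{k,t}$ be the number of vertices of degree $k$ in $G_m^t$, and let $d(V_t)$ be the degree of a vertex $V_t$ chosen uniformly at random in $G_m^t$. A Yule process of intensity $\lambda>0$ with $a\ge1$ initial individuals is a time-homogeneous Markov counting process $(N(T))_{T\ge0}$ with $N(0)=a$ almost surely and, as $h\downarrow0$, $\mathbb P(N(T+h)=k+\ell\mid N(T)=k)$ equal to $k\lambda h+o(h)$ for $\ell=1$, to $o(h)$ for $\ell>1$, and to $1-k\lambda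 h+o(h)$ for $\ell=0$. In the $m$-Yule model with parameters $\lambda,\beta$ the genera appear as a Yule process of intensity $\beta$ with one genus at time $0$, and whenever a genus appears, a Yule process of intensity $\lambda$ with $m$ initial individuals starts, which counts the species of this genus (its size); these copies are independent of one another and of the process of appearance of genera. Let $\mathcal N_T^m$ be the size at time $T$ of a genus chosen uniformly at random among those present at time $T$ in the $m$-Yule model with $\lambda=1/2$ and $\beta=1$. **Theorem.** Let $t=n(m+1)$. Then: 1. for every $k\ge m$ the two limits $$p_k:=\lim_{n\to\infty}\mathbb P(d(V_t)=k)=\lim_{T\to\infty}\mathbb P(\mathcal N_T^m=k)$$ exist and are equal; 2. for every $C>m\sqrt8$, $$\lim_{n\to\infty}\mathbb P\left(\max_k\left|\frac{N_{k,t}}{n}-\mathbb P(d(V_t)=k)\right|\ge C\sqrt{\frac{(m+1)\ln(n(m+1))}{n}}\right)=0;$$ 3. for every $k\ge m$, $N_{k,t}/n\to p_k$ in probability as $n\to\infty$. -/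

import Mathlib

open MeasureTheory ProbabilityTheory Filter Asymptotics
open scoped Topology NNReal

/-! ### Multigraphs and the Barabási–Albert process -/

/-- A finite multigraph (loops and multiple edges allowed) with vertices labelled
`1, …, numVertices`; an edge from `u` to `v` is recorded as the pair `(u, v)`. -/
structure MultiGraph where
  numVertices : ℕ
  edges : Multiset (ℕ × ℕ)

namespace MultiGraph

/-- Events about a random multigraph: every set of multigraphs (there are countably many) is
measurable. -/
instance : MeasurableSpace MultiGraph := ⊤

/-- The set of vertices. -/
def vertices (g : MultiGraph) : Finset ℕ := Finset.Icc 1 g.numVertices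

/-- The degree of a vertex: the number of edge ends at it, so that a loop counts twice. -/
def degree (g : MultiGraph) (v : ℕ) : ℕ :=
  (g.edges.map Prod.fst).count v + (g.edges.map Prod.snd).count v

/-- The number of vertices of degree `k`. -/
def degreeCount (g : MultiGraph) (k : ℕ) : ℕ :=
  (g.vertices.filter fun v => g.degree v = k).card

/-- Add one new isolated vertex. -/
def addVertex (g : MultiGraph) : MultiGraph := ⟨g.numVertices + 1, g.edges⟩

/-- Add one edge from `u` to `v`. -/
def addEdge (g : MultiGraph) (u v : ℕ) : MultiGraph := ⟨g.numVertices, (u, v) ::ₘ g.edges⟩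

end MultiGraph

/-- The probability that the edge added at time `n (m + 1) + i` goes from `v_{n+1}` to `v`, when
the graph before this edge is `g`. -/
noncomputable def baAttachProb (m n i : ℕ) (g : MultiGraph) (v : ℕ) : ℝ :=
  (if v = n + 1 then (g.degree v : ℝ) + 1 else (g.degree v : ℝ)) /
    (2 * ((m : ℝ) * n + i - 1) - 1)

/-- `(G t)_{t ≥ 1}` is the Barabási–Albert random graph process with parameter `m` under `P`.
It starts at time `1` with the single vertex `v_1` and no edge; at time `n (m + 1) + 1` the vertex
`v_{n+1}` is added; at time `n (m + 1) + i`, `2 ≤ i ≤ m + 1`, an edge from `v_{n+1}` is added, whose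
other end has, conditionally on the whole past, the law `baAttachProb`. (`G 0` plays no role.) -/
structure IsBAProcess {Ω : Type*} [MeasurableSpace Ω] (P : Measure Ω) (m : ℕ)
    (G : ℕ → Ω → MultiGraph) : Prop where
  measurable : ∀ t, Measurable (G t)
  initial : ∀ᵐ ω ∂P, G 1 ω = ⟨1, 0⟩
  vertex_step : ∀ n : ℕ, 1 ≤ n →
    ∀ᵐ ω ∂P, G (n * (m + 1) + 1) ω = (G (n * (m + 1)) ω).addVertex
  edge_step : ∀ n i : ℕ, 2 ≤ i → i ≤ m + 1 → ∀ g : ℕ → MultiGraph, ∀ v ∈ Finset.Icc 1 (n + 1),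
    P.real {ω | (∀ s, 1 ≤ s → s < n * (m + 1) + i → G s ω = g s) ∧
        G (n * (m + 1) + i) ω = (g (n * (m + 1) + i - 1)).addEdge (n + 1) v} =
      P.real {ω | ∀ s, 1 ≤ s → s < n * (m + 1) + i → G s ω = g s} *
        baAttachProb m n i (g (n * (m + 1) + i - 1)) v

/-- For every `t ≥ 1`, `V t` is a vertex chosen uniformly at random in the random graph `G t`:
given `G t = g`, it is uniformly distributed on the vertices of `g`. -/
structure IsUniformVertex {Ω : Type*} [MeasurableSpace Ω] (P : Measure Ω)
    (G : ℕ → Ω → MultiGraph) (V : ℕ → Ω → ℕ) : Prop where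
  measurable : ∀ t, Measurable (V t)
  uniform : ∀ t : ℕ, 1 ≤ t → ∀ g : MultiGraph, ∀ v ∈ g.vertices,
    P.real {ω | G t ω = g ∧ V t ω = v} = P.real {ω | G t ω = g} / (g.numVertices : ℝ)

/-! ### Yule processes and the `m`-Yule model -/

/-- The σ-algebra generated by the process `N` up to time `T`. -/
@[reducible] def pastSigma {Ω : Type*} (N : ℝ≥0 → Ω → ℕ) (T : ℝ≥0) : MeasurableSpace Ω :=
  ⨆ s : Set.Iic T, MeasurableSpace.comap (N s) ⊤

/-- Infinitesimal transition probabilities of a linear birth process with birth intensity `lam`;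
`p h k j` is the probability to pass from state `k` to state `j` in a time interval of length `h`. -/
structure IsYuleTransition (lam : ℝ) (p : ℝ≥0 → ℕ → ℕ → ℝ) : Prop where
  one_birth : ∀ k : ℕ,
    (fun h : ℝ≥0 => p h k (k + 1) - k * lam * h) =o[𝓝[>] 0] (fun h : ℝ≥0 => (h : ℝ))
  many_births : ∀ k l : ℕ, 1 < l →
    (fun h : ℝ≥0 => p h k (k + l)) =o[𝓝[>] 0] (fun h : ℝ≥0 => (h : ℝ))
  no_birth : ∀ k : ℕ,
    (fun h : ℝ≥0 => p h k k - (1 - k * lam * h)) =o[𝓝[>] 0] (fun h : ℝ≥0 => (h : ℝ))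

/-- `N` is a Yule process under `P` with birth intensity `lam` and `a` initial individuals: a
counting process (nondecreasing right-continuous `ℕ`-valued paths) which starts from `a` and is a
time-homogeneous Markov process with the above infinitesimal transition probabilities. -/
structure IsYuleProcess {Ω : Type*} [MeasurableSpace Ω] (P : Measure Ω) (lam : ℝ) (a : ℕ)
    (N : ℝ≥0 → Ω → ℕ) : Prop where
  measurable : ∀ T, Measurable (N T)
  initial : ∀ᵐ ω ∂P, N 0 ω = a
  monotone : ∀ ω, Monotone fun T => N T ω
  rightContinuous : ∀ ω T, ContinuousWithinAt (fun s => N s ω) (Set.Ici T) T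
  markov : ∃ p : ℝ≥0 → ℕ → ℕ → ℝ, IsYuleTransition lam p ∧
    ∀ (T h : ℝ≥0) (A : Set Ω), MeasurableSet[pastSigma N T] A → ∀ k j : ℕ,
      P.real (A ∩ {ω | N T ω = k} ∩ {ω | N (T + h) ω = j}) =
        P.real (A ∩ {ω | N T ω = k}) * p h k j

/-- The `m`-Yule model with parameters `lam` (species) and `β` (genera). `N T` is the number of
genera at time `T`, and `X j` is the process of the number of species in the genus number `j`
(`j = 0, 1, …` in order of appearance) as a function of the age of the genus. -/
structure IsYuleModel {Ω : Type*} [MeasurableSpace Ω] (P : Measure Ω) (m : ℕ) (lam β : ℝ)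
    (N : ℝ≥0 → Ω → ℕ) (X : ℕ → ℝ≥0 → Ω → ℕ) : Prop where
  genera : IsYuleProcess P β 1 N
  species : ∀ j, IsYuleProcess P lam m (X j)
  indep_copies : iIndepFun (fun (j : ℕ) (ω : Ω) (T : ℝ≥0) => X j T ω) P
  indep_genera : IndepFun (fun (ω : Ω) (T : ℝ≥0) => N T ω)
    (fun (ω : Ω) (j : ℕ) (T : ℝ≥0) => X j T ω) P

/-- The time at which genus number `j` appears (`j = 0` is the initial genus). -/
noncomputable def genusBirthTime {Ω : Type*} (N : ℝ≥0 → Ω → ℕ) (j : ℕ) (ω : Ω) : ℝ≥0 :=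
  sInf {T : ℝ≥0 | j + 1 ≤ N T ω}

/-- The size (number of species) at time `T` of genus number `j`, meant for genera that have
appeared by time `T`, that is for `j < N T ω`. -/
noncomputable def genusSize {Ω : Type*} (N : ℝ≥0 → Ω → ℕ) (X : ℕ → ℝ≥0 → Ω → ℕ)
    (T : ℝ≥0) (j : ℕ) (ω : Ω) : ℕ :=
  X j (T - genusBirthTime N j ω) ω

/-- The σ-algebra generated by the whole Yule model. -/
@[reducible] def yuleModelSigma {Ω : Type*} (N : ℝ≥0 → Ω → ℕ) (X : ℕ → ℝ≥0 → Ω → ℕ) : MeasurableSpace Ω :=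
  (⨆ T : ℝ≥0, MeasurableSpace.comap (N T) ⊤) ⊔
    ⨆ (j : ℕ) (T : ℝ≥0), MeasurableSpace.comap (X j T) ⊤

/-- For every time `T`, `J T` is (the number of) a genus chosen uniformly at random among those
present at time `T`: conditionally on the whole Yule model, `J T` is uniformly distributed on
`{0, …, N T - 1}`. -/
structure IsUniformGenus {Ω : Type*} [MeasurableSpace Ω] (P : Measure Ω)
    (N : ℝ≥0 → Ω → ℕ) (X : ℕ → ℝ≥0 → Ω → ℕ) (J : ℝ≥0 → Ω → ℕ) : Prop where
  measurable : ∀ T, Measurable (J T)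
  uniform : ∀ (T : ℝ≥0) (A : Set Ω), MeasurableSet[yuleModelSigma N X] A →
    ∀ r j : ℕ, j < r →
      P.real (A ∩ {ω | N T ω = r} ∩ {ω | J T ω = j}) = P.real (A ∩ {ω | N T ω = r}) / (r : ℝ)

/-! ### Partitions by countably valued maps -/

/-! Both models lead to one recursion: the common limit `p = limitLaw m` satisfies `(1 + k/2) p k =
1_{k = m} + (k - 1)/2 * p (k - 1)` for `k ≥ 1`.

Graphs. An edge reaches an older vertex of degree `d` with probability `d / D`, where `D` is `2 m n
+ O(1)`. Over the `m` edges of a block the expected number `E k` of old vertices of degree `k`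
therefore loses about `k E k / (2 n)` and gains about `(k - 1) E (k - 1) / (2 n)`. The vertex that
then becomes old has degree `m` up to probability `O(1 / n)`, the order of the loop probability. By
induction on `k`, `tendsto_div_of_damped_recursion` turns this into `E k / n → p k`
(`tendsto_expOldCount_div`).

Concentration. The number of vertices of degree `k` is a sum of functions of single degrees
(`degreeSum`). Preferential attachment maps such sums to such sums, so all conditional expectations
of the count have this form, with weights in `[0, 1]`. One edge changes such a sum by at most 2
about its conditional mean, and Azuma's argument (`integral_exp_degreeSum_le`) yields Gaussian tails
of variance proxy `4 m (n + 1)` for the graph with `n + 1` vertices. A union bound over the `O(n)`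
possible degrees controls the maximum, and a fixed `k` gives convergence in probability.

Yule model. The infinitesimal description determines the negative binomial transition law
`yuleProb`, through uniqueness for the forward equation. The genera older than `x` at time `T`
number `N (T - x)`, so a uniform genus has age at least `x` with probability `E[N (T - x) / N T]`,
which tends to `exp (-x)`. Its size is a Yule process at that independent age, hence the limit law
is `∫ yuleProb (1/2) m k x * exp (-x)`. Integration by parts turns the forward equation into the
recursion for `p` (`integral_yuleProb_mul_exp_neg`). -/

theorem hasSum_measureReal_inter_fiber {Ω ι : Type*} [MeasurableSpace Ω] [Countable ι]
    (P : Measure Ω) [IsFiniteMeasure P] {X : Ω → ι} (hX : ∀ x, MeasurableSet {ω | X ω = x})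
    {E : Set Ω} (hE : MeasurableSet E) :
    HasSum (fun x => P.real (E ∩ {ω | X ω = x})) (P.real E) := by
  have h1 : P E = ∑' x, P (E ∩ {ω | X ω = x}) := by
    rw [← measure_iUnion]
    · congr 1; ext ω; simp
    · intro x y hxy
      refine Set.disjoint_left.2 fun ω h1 h2 => hxy ?_
      exact h1.2.symm.trans h2.2
    · exact fun x => hE.inter (hX x)
  have h2 : (∑' x, P (E ∩ {ω | X ω = x})) ≠ ⊤ := h1 ▸ measure_ne_top P E
  have h3 := ENNReal.hasSum_toReal h2
  rw [← ENNReal.tsum_toReal_eq (fun x => measure_ne_top _ _), ← h1] at h3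
  exact h3

/-! ### Shape and one-step transitions of the Barabási–Albert graph. -/

namespace MultiGraph

instance : Countable MultiGraph :=
  Function.Injective.countable (f := fun g : MultiGraph => (g.numVertices, g.edges)) (by
    rintro ⟨a, b⟩ ⟨c, d⟩ h; simpa using h)

instance : DiscreteMeasurableSpace MultiGraph := ⟨fun _ => trivial⟩

theorem addEdge_injective (g : MultiGraph) (u : ℕ) : Function.Injective (g.addEdge u) := by
  intro v w h
  simpa [addEdge] using h

theorem degree_addEdge (g : MultiGraph) (u v w : ℕ) :
    (g.addEdge u v).degree w =
      g.degree w + (if w = u then 1 else 0) + (if w = v then 1 else 0) := by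
  simp only [degree, addEdge, Multiset.map_cons, Multiset.count_cons]
  ring

theorem degree_addVertex (g : MultiGraph) (w : ℕ) : g.addVertex.degree w = g.degree w := rfl

end MultiGraph

/-- The shape of the Barabási–Albert graph at time `n (m + 1) + i`: it has `n + 1` vertices and
`m n + i - 1` edges. -/
structure IsBAState (m n i : ℕ) (g : MultiGraph) : Prop where
  numVertices : g.numVertices = n + 1
  card_edges : g.edges.card + 1 = m * n + i
  fst_mem : ∀ x ∈ g.edges, x.1 ∈ Finset.Icc 1 (n + 1)
  snd_mem : ∀ x ∈ g.edges, x.2 ∈ Finset.Icc 1 (n + 1)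

namespace IsBAState

variable {m n i : ℕ} {g : MultiGraph}

theorem initial : IsBAState m 0 1 ⟨1, 0⟩ := ⟨rfl, by simp, by simp, by simp⟩

theorem addVertex (h : IsBAState m n (m + 1) g) : IsBAState m (n + 1) 1 g.addVertex where
  numVertices := by simp [MultiGraph.addVertex, h.numVertices]
  card_edges := by
    have := h.card_edges
    simp only [MultiGraph.addVertex]
    rw [this]; ring
  fst_mem x hx := by
    have := h.fst_mem x hx
    simp only [Finset.mem_Icc] at this ⊢
    omega
  snd_mem x hx := by
    have := h.snd_mem x hx
    simp only [Finset.mem_Icc] at this ⊢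
    omega

theorem addEdge (h : IsBAState m n i g) {v : ℕ} (hv : v ∈ Finset.Icc 1 (n + 1)) :
    IsBAState m n (i + 1) (g.addEdge (n + 1) v) where
  numVertices := h.numVertices
  card_edges := by
    have := h.card_edges
    simp only [MultiGraph.addEdge, Multiset.card_cons]
    omega
  fst_mem x hx := by
    simp only [MultiGraph.addEdge, Multiset.mem_cons] at hx
    rcases hx with rfl | hx
    · simp
    · exact h.fst_mem x hx
  snd_mem x hx := by
    simp only [MultiGraph.addEdge, Multiset.mem_cons] at hx
    rcases hx with rfl | hx
    · exact hv
    · exact h.snd_mem x hx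

/-- Handshake lemma for `m n + i - 1` edges; the `+ 2` avoids a truncated subtraction. -/
theorem sum_degree (h : IsBAState m n i g) :
    ∑ v ∈ Finset.Icc 1 (n + 1), g.degree v + 2 = 2 * (m * n + i) := by
  simp only [MultiGraph.degree, Finset.sum_add_distrib]
  rw [Multiset.sum_count_eq_card, Multiset.sum_count_eq_card]
  · have := h.card_edges
    simp only [Multiset.card_map]
    omega
  · intro a ha
    obtain ⟨x, hx, rfl⟩ := Multiset.mem_map.1 ha
    exact h.snd_mem x hx
  · intro a ha
    obtain ⟨x, hx, rfl⟩ := Multiset.mem_map.1 ha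
    exact h.fst_mem x hx

theorem degree_add_two_le (h : IsBAState m n i g) {v : ℕ} (hv : v ∈ Finset.Icc 1 (n + 1)) :
    g.degree v + 2 ≤ 2 * (m * n + i) := by
  rw [← h.sum_degree]
  have := Finset.single_le_sum (f := fun v => g.degree v) (fun _ _ => Nat.zero_le _) hv
  simpa using this

theorem degree_eq_zero (h : IsBAState m n i g) {v : ℕ} (hv : n + 1 < v) : g.degree v = 0 := by
  simp only [MultiGraph.degree, Nat.add_eq_zero_iff, Multiset.count_eq_zero, Multiset.mem_map,
    not_exists, not_and]
  constructor <;> intro x hx hxv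
  · have := h.fst_mem x hx
    rw [Finset.mem_Icc] at this; omega
  · have := h.snd_mem x hx
    rw [Finset.mem_Icc] at this; omega

end IsBAState

/-- The normalisation of the attachment probabilities for the edge added to a graph with
`m n + i - 1` edges. -/
noncomputable def baDenom (m n i : ℕ) : ℝ := 2 * ((m : ℝ) * n + i) - 1

/-- Index shift: `IsBAState` and `baDenom` refer to the time before the edge, `baAttachProb` to the
time after it. -/
theorem baAttachProb_succ (m n i : ℕ) (g : MultiGraph) (v : ℕ) :
    baAttachProb m n (i + 1) g v =
      (if v = n + 1 then (g.degree v : ℝ) + 1 else (g.degree v : ℝ)) / baDenom m n i := by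
  simp only [baAttachProb, baDenom]
  push_cast
  congr 2
  ring

theorem one_le_baDenom (m n : ℕ) {i : ℕ} (hi : 1 ≤ i) : 1 ≤ baDenom m n i := by
  have h1 : (1 : ℝ) ≤ i := by exact_mod_cast hi
  have h2 : (0 : ℝ) ≤ (m : ℝ) * n := by positivity
  unfold baDenom
  linarith

theorem baAttachProb_nonneg (m n : ℕ) {i : ℕ} (hi : 1 ≤ i) (g : MultiGraph) (v : ℕ) :
    0 ≤ baAttachProb m n (i + 1) g v := by
  rw [baAttachProb_succ]
  have := one_le_baDenom m n hi
  split_ifs <;> positivity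

/-- The degrees sum to `2 (m n + i) - 2`, and the end of the edge already fixed at `n + 1` supplies
the missing 1. -/
theorem IsBAState.sum_baAttachProb {m n i : ℕ} {g : MultiGraph} (hi : 1 ≤ i)
    (h : IsBAState m n i g) :
    ∑ v ∈ Finset.Icc 1 (n + 1), baAttachProb m n (i + 1) g v = 1 := by
  simp only [baAttachProb_succ]
  rw [← Finset.sum_div, div_eq_one_iff_eq (by linarith [one_le_baDenom m n hi])]
  have h1 : ∀ v ∈ Finset.Icc 1 (n + 1),
      (if v = n + 1 then (g.degree v : ℝ) + 1 else (g.degree v : ℝ)) =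
        g.degree v + if v = n + 1 then 1 else 0 := by
    intro v _; split_ifs <;> simp
  rw [Finset.sum_congr rfl h1, Finset.sum_add_distrib, Finset.sum_ite_eq']
  have h2 : ((∑ v ∈ Finset.Icc 1 (n + 1), g.degree v : ℕ) : ℝ) + 2 = 2 * ((m : ℝ) * n + i) := by
    exact_mod_cast h.sum_degree
  push_cast at h2
  simp only [Finset.mem_Icc, le_refl, le_add_iff_nonneg_left, zero_le, and_self, if_true, baDenom]
  linarith

/-- Induction along the times `n (m + 1) + i` of the Barabási–Albert process. -/
theorem ba_induction (m : ℕ) {C : ℕ → ℕ → Prop} (initial : C 0 1)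
    (vertex : ∀ n, C n (m + 1) → C (n + 1) 1)
    (edge : ∀ n i, 1 ≤ i → i ≤ m → C n i → C n (i + 1)) :
    ∀ n i, 1 ≤ i → i ≤ m + 1 → C n i := by
  have aux : ∀ n, C n 1 → ∀ i, 1 ≤ i → i ≤ m + 1 → C n i := by
    intro n h1 i hi
    induction i, hi using Nat.le_induction with
    | base => exact fun _ => h1
    | succ i hi ih => exact fun hm => edge n i hi (by omega) (ih (by omega))
  intro n
  induction n with
  | zero => exact aux 0 initial
  | succ n ih => exact aux (n + 1) (vertex n (ih (m + 1) (by omega) le_rfl))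

namespace IsBAProcess

variable {Ω : Type*} [MeasurableSpace Ω] {P : Measure Ω} {m : ℕ} {G : ℕ → Ω → MultiGraph}

theorem measurableSet_eq (hG : IsBAProcess P m G) (t : ℕ) (g : MultiGraph) :
    MeasurableSet {ω | G t ω = g} := hG.measurable t (MeasurableSet.of_discrete (s := {g}))

theorem measurableSet_path (hG : IsBAProcess P m G) (j t : ℕ) (g : ℕ → MultiGraph) :
    MeasurableSet {ω | ∀ s, j ≤ s → s < t → G s ω = g s} := by
  simp only [Set.ofPred_forall]
  exact MeasurableSet.iInter fun s => MeasurableSet.iInter fun _ => MeasurableSet.iInter fun _ =>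
    hG.measurableSet_eq s _

/-- The one-step transition probabilities, conditionally on the present only. -/
theorem edge_transition [IsFiniteMeasure P] (hG : IsBAProcess P m G) {n i : ℕ} (hi : 1 ≤ i)
    (him : i ≤ m) (g : MultiGraph) {v : ℕ} (hv : v ∈ Finset.Icc 1 (n + 1)) :
    P.real {ω | G (n * (m + 1) + i) ω = g ∧ G (n * (m + 1) + i + 1) ω = g.addEdge (n + 1) v} =
      P.real {ω | G (n * (m + 1) + i) ω = g} * baAttachProb m n (i + 1) g v := by
  set t := n * (m + 1) + i with ht
  -- The process is defined by conditioning on the whole past from time 1. Summing over the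
  -- countably many values of `G j` removes the constraint at time `j`, so induction on `j` leaves
  -- only time `t`.
  have key : ∀ j, 1 ≤ j → j ≤ t → ∀ p : ℕ → MultiGraph,
      P.real {ω | (∀ s, j ≤ s → s < t + 1 → G s ω = p s) ∧
          G (t + 1) ω = (p t).addEdge (n + 1) v} =
        P.real {ω | ∀ s, j ≤ s → s < t + 1 → G s ω = p s} * baAttachProb m n (i + 1) (p t) v := by
    intro j hj
    induction j, hj using Nat.le_induction with
    | base =>
      intro _ p
      have := hG.edge_step n (i + 1) (by omega) (by omega) p v hv
      simpa [ht, add_assoc] using this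
    | succ j hj ih =>
      intro hjt p
      have hsplit : ∀ x, ∀ ω, ((∀ s, j + 1 ≤ s → s < t + 1 → G s ω = p s) ∧ G j ω = x) ↔
          ∀ s, j ≤ s → s < t + 1 → G s ω = Function.update p j x s := by
        intro x ω
        constructor
        · rintro ⟨h1, h2⟩ s hs hst
          rcases eq_or_lt_of_le hs with rfl | hs
          · simpa using h2
          · rw [Function.update_of_ne (by omega)]
            exact h1 s hs hst
        · intro h
          refine ⟨fun s hs hst => ?_, ?_⟩
          · have := h s (by omega) hst
            rwa [Function.update_of_ne (by omega)] at this
          · simpa using h j le_rfl (by omega)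
      have hpt : ∀ x, Function.update p j x t = p t := fun x => by
        rw [Function.update_of_ne (by omega)]
      have hA := hasSum_measureReal_inter_fiber P (hG.measurableSet_eq j)
        (hG.measurableSet_path (j + 1) (t + 1) p)
      have hB := hasSum_measureReal_inter_fiber P (hG.measurableSet_eq j)
        ((hG.measurableSet_path (j + 1) (t + 1) p).inter
          (hG.measurableSet_eq (t + 1) ((p t).addEdge (n + 1) v)))
      refine hB.unique ((hA.mul_right (baAttachProb m n (i + 1) (p t) v)).congr_fun ?_)
      intro x
      have h1 := ih (by omega) (Function.update p j x)
      rw [hpt] at h1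
      refine (congrArg P.real (Set.ext fun ω => ?_)).trans
        (h1.trans (congrArg (fun E => P.real E * _) (Set.ext fun ω => ?_)))
      · simp only [Set.mem_inter_iff, Set.mem_ofPred_eq]
        rw [← hsplit]
        tauto
      · simp only [Set.mem_inter_iff, Set.mem_ofPred_eq]
        rw [← hsplit]
  have hset : ∀ ω, (∀ s, t ≤ s → s < t + 1 → G s ω = g) ↔ G t ω = g := by
    refine fun ω => ⟨fun h => h t le_rfl (by omega), fun h s h1 h2 => ?_⟩
    obtain rfl : s = t := by omega
    exact h
  simpa only [hset] using key t (by omega) le_rfl fun _ => g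

end IsBAProcess

/-! ### Random variables with finitely many values -/

section FiniteSupport

variable {Ω ι : Type*} [MeasurableSpace Ω] {P : Measure Ω} {X : Ω → ι} {S : Finset ι}

theorem ae_eq_sum_indicator_fiber (hS : ∀ᵐ ω ∂P, X ω ∈ S) (h : ι → ℝ) :
    (fun ω => h (X ω)) =ᵐ[P] fun ω => ∑ x ∈ S, {ω | X ω = x}.indicator (fun _ => h x) ω := by
  filter_upwards [hS] with ω hω
  rw [Finset.sum_eq_single (X ω)]
  · simp
  · intro b _ hb
    exact Set.indicator_of_notMem (fun h' => hb h'.symm) _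
  · exact fun h' => absurd hω h'

theorem integrable_of_ae_mem_finset [IsFiniteMeasure P] (hX : ∀ x, MeasurableSet {ω | X ω = x})
    (hS : ∀ᵐ ω ∂P, X ω ∈ S) (h : ι → ℝ) : Integrable (fun ω => h (X ω)) P := by
  refine Integrable.congr ?_ (ae_eq_sum_indicator_fiber hS h).symm
  exact integrable_finsetSum _ fun x _ => (integrable_const _).indicator (hX x)

theorem integral_eq_sum_of_ae_mem_finset [IsFiniteMeasure P] (hX : ∀ x, MeasurableSet {ω | X ω = x})
    (hS : ∀ᵐ ω ∂P, X ω ∈ S) (h : ι → ℝ) :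
    ∫ ω, h (X ω) ∂P = ∑ x ∈ S, P.real {ω | X ω = x} * h x := by
  rw [integral_congr_ae (ae_eq_sum_indicator_fiber hS h),
    integral_finsetSum _ fun x _ => (integrable_const _).indicator (hX x)]
  refine Finset.sum_congr rfl fun x _ => ?_
  rw [integral_indicator (hX x), setIntegral_const, smul_eq_mul]

end FiniteSupport

/-- The one-step transition operator of the Barabási–Albert process when an edge is added to a
graph with `n + 1` vertices and `m n + i - 1` edges. -/
noncomputable def baEdgeOp (m n i : ℕ) (h : MultiGraph → ℝ) (g : MultiGraph) : ℝ :=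
  ∑ v ∈ Finset.Icc 1 (n + 1), baAttachProb m n (i + 1) g v * h (g.addEdge (n + 1) v)

namespace IsBAProcess

variable {Ω : Type*} [MeasurableSpace Ω] {P : Measure Ω} {m : ℕ} {G : ℕ → Ω → MultiGraph}

/-- At an admissible graph the attachment probabilities sum to one, so the prescribed edges exhaust
the event `G t = g` up to a null set; countability of the graphs treats all `g` at once. -/
theorem ae_addEdge [IsFiniteMeasure P] (hG : IsBAProcess P m G) {n i : ℕ} (hi : 1 ≤ i)
    (him : i ≤ m) (hst : ∀ᵐ ω ∂P, IsBAState m n i (G (n * (m + 1) + i) ω)) :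
    ∀ᵐ ω ∂P, ∃ v ∈ Finset.Icc 1 (n + 1),
      G (n * (m + 1) + i + 1) ω = (G (n * (m + 1) + i) ω).addEdge (n + 1) v := by
  set t := n * (m + 1) + i with ht
  have key : ∀ g, ∀ᵐ ω ∂P, G t ω = g → IsBAState m n i g →
      ∃ v ∈ Finset.Icc 1 (n + 1), G (t + 1) ω = g.addEdge (n + 1) v := by
    intro g
    by_cases hg : IsBAState m n i g
    swap
    · exact ae_of_all _ fun _ _ h => absurd h hg
    set U : Set Ω := ⋃ v ∈ Finset.Icc 1 (n + 1), {ω | G t ω = g ∧ G (t + 1) ω = g.addEdge (n + 1) v}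
    have hmeas : ∀ v, MeasurableSet {ω | G t ω = g ∧ G (t + 1) ω = g.addEdge (n + 1) v} :=
      fun v => (hG.measurableSet_eq t g).inter (hG.measurableSet_eq (t + 1) _)
    have hU : P.real U = P.real {ω | G t ω = g} := by
      rw [measureReal_biUnion_finset]
      · rw [Finset.sum_congr rfl fun v hv => hG.edge_transition hi him g hv, ← Finset.mul_sum,
          hg.sum_baAttachProb hi, mul_one]
      · intro v _ w _ hvw
        refine Set.disjoint_left.2 fun ω h1 h2 => hvw ?_
        exact g.addEdge_injective (n + 1) (h1.2.symm.trans h2.2)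
      · exact fun v _ => hmeas v
    have hsub : U ⊆ {ω | G t ω = g} := Set.iUnion₂_subset fun v _ ω h => h.1
    have hnull : P ({ω | G t ω = g} \ U) = 0 := by
      rw [← measureReal_eq_zero_iff, measureReal_sdiff hsub
        (Finset.measurableSet_biUnion _ fun v _ => hmeas v), hU, sub_self]
    have hae : ∀ᵐ ω ∂P, ω ∉ {ω | G t ω = g} \ U :=
      measure_eq_zero_iff_ae_notMem.1 hnull
    filter_upwards [hae] with ω h h1 _
    have h2 : ω ∈ U := by
      by_contra h3
      exact h ⟨h1, h3⟩
    simp only [U, Set.mem_iUnion] at h2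
    obtain ⟨v, hv, h3⟩ := h2
    exact ⟨v, hv, h3.2⟩
  filter_upwards [hst, ae_all_iff.2 key] with ω h1 h2
  exact h2 _ rfl h1

/-- At each time the Barabási–Albert graph has almost surely finitely many possible values, all of
the expected shape. -/
theorem exists_finset [IsFiniteMeasure P] (hG : IsBAProcess P m G) :
    ∀ n i, 1 ≤ i → i ≤ m + 1 → ∃ S : Finset MultiGraph, (∀ g ∈ S, IsBAState m n i g) ∧
      ∀ᵐ ω ∂P, G (n * (m + 1) + i) ω ∈ S := by
  classical
  refine ba_induction m ?_ ?_ ?_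
  · refine ⟨{⟨1, 0⟩}, by simpa using IsBAState.initial, ?_⟩
    simpa using hG.initial
  · rintro n ⟨S, hS, hGS⟩
    refine ⟨S.image MultiGraph.addVertex, ?_, ?_⟩
    · simp only [Finset.mem_image, forall_exists_index, and_imp, forall_apply_eq_imp_iff₂]
      exact fun g hg => (hS g hg).addVertex
    · filter_upwards [hGS, hG.vertex_step (n + 1) (by omega)] with ω h1 h2
      rw [h2]
      refine Finset.mem_image_of_mem _ ?_
      convert h1 using 2
      ring
  · rintro n i hi him ⟨S, hS, hGS⟩
    refine ⟨(S ×ˢ Finset.Icc 1 (n + 1)).image fun x => x.1.addEdge (n + 1) x.2, ?_, ?_⟩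
    · intro g hg
      obtain ⟨x, hx, rfl⟩ := Finset.mem_image.1 hg
      rw [Finset.mem_product] at hx
      exact (hS _ hx.1).addEdge hx.2
    · filter_upwards [hGS, hG.ae_addEdge hi him (hGS.mono fun ω => hS _)] with ω h1 h2
      obtain ⟨v, hv, h3⟩ := h2
      rw [← add_assoc, h3]
      exact Finset.mem_image.2 ⟨(_, v), Finset.mem_product.2 ⟨h1, hv⟩, rfl⟩

theorem ae_isBAState [IsFiniteMeasure P] (hG : IsBAProcess P m G) {n i : ℕ} (hi : 1 ≤ i)
    (him : i ≤ m + 1) : ∀ᵐ ω ∂P, IsBAState m n i (G (n * (m + 1) + i) ω) := by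
  obtain ⟨S, hS, hGS⟩ := hG.exists_finset n i hi him
  exact hGS.mono fun ω => hS _

theorem integrable [IsFiniteMeasure P] (hG : IsBAProcess P m G) {n i : ℕ} (hi : 1 ≤ i)
    (him : i ≤ m + 1) (h : MultiGraph → ℝ) :
    Integrable (fun ω => h (G (n * (m + 1) + i) ω)) P := by
  obtain ⟨S, hS, hGS⟩ := hG.exists_finset n i hi him
  exact integrable_of_ae_mem_finset (hG.measurableSet_eq _) hGS h

/-- Integrated Markov property. Both graphs take finitely many values, so it is a finite sum of
instances of `edge_transition`. -/
theorem integral_edge_step [IsFiniteMeasure P] (hG : IsBAProcess P m G) {n i : ℕ} (hi : 1 ≤ i)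
    (him : i ≤ m) (h : MultiGraph → ℝ) :
    ∫ ω, h (G (n * (m + 1) + (i + 1)) ω) ∂P =
      ∫ ω, baEdgeOp m n i h (G (n * (m + 1) + i) ω) ∂P := by
  classical
  obtain ⟨S, hS, hGS⟩ := hG.exists_finset n i hi (by omega)
  set t := n * (m + 1) + i with ht
  rw [← add_assoc, ← ht]
  have hpair := hG.ae_addEdge hi him (hGS.mono fun ω => hS _)
  rw [← ht] at hpair
  have h1 : ∀ᵐ ω ∂P, (G t ω, G (t + 1) ω) ∈
      (S ×ˢ Finset.Icc 1 (n + 1)).image fun x => (x.1, x.1.addEdge (n + 1) x.2) := by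
    filter_upwards [hGS, hpair] with ω h1 ⟨v, hv, h3⟩
    rw [h3]
    exact Finset.mem_image.2 ⟨(_, v), Finset.mem_product.2 ⟨h1, hv⟩, rfl⟩
  have hmeas : ∀ x : MultiGraph × MultiGraph, MeasurableSet {ω | (G t ω, G (t + 1) ω) = x} := by
    intro x
    have := (hG.measurableSet_eq t x.1).inter (hG.measurableSet_eq (t + 1) x.2)
    convert this using 1
    ext ω
    simp [Prod.ext_iff]
  rw [integral_eq_sum_of_ae_mem_finset (hG.measurableSet_eq t) hGS,
    integral_eq_sum_of_ae_mem_finset (X := fun ω => (G t ω, G (t + 1) ω)) hmeas h1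
      (fun x => h x.2), Finset.sum_image, Finset.sum_product]
  · refine Finset.sum_congr rfl fun g _ => ?_
    rw [baEdgeOp, Finset.mul_sum]
    refine Finset.sum_congr rfl fun v hv => ?_
    rw [← mul_assoc, ← hG.edge_transition hi him g hv]
    simp only [Prod.mk.injEq, ht]
  · rintro ⟨g, v⟩ _ ⟨g', v'⟩ _ hx
    simp only [Prod.mk.injEq] at hx
    obtain ⟨rfl, hx⟩ := hx
    rw [g.addEdge_injective _ hx]

theorem integral_vertex_step (hG : IsBAProcess P m G) (n : ℕ) (h : MultiGraph → ℝ) :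
    ∫ ω, h (G ((n + 1) * (m + 1) + 1) ω) ∂P =
      ∫ ω, h (G (n * (m + 1) + (m + 1)) ω).addVertex ∂P := by
  refine integral_congr_ae ?_
  filter_upwards [hG.vertex_step (n + 1) (by omega)] with ω h1
  rw [h1]
  congr 3
  ring

end IsBAProcess

/-! ### Additive functionals of the degrees -/

/-- A functional of a graph that is additive in the degrees of its vertices, where the last vertex
`n + 1` may be weighted differently. -/
noncomputable def degreeSum (n : ℕ) (a b : ℕ → ℝ) (c : ℝ) (g : MultiGraph) : ℝ :=
  ∑ v ∈ Finset.Icc 1 n, a (g.degree v) + b (g.degree (n + 1)) + c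

/-- The effect of one edge on a function of the degree of an older vertex. -/
def oldVertexOp (w a : ℕ → ℝ) (d : ℕ) : ℝ := a d + w d * (a (d + 1) - a d)

/-- The effect of one edge on a function of the degree of the newest vertex. -/
def newVertexOp (w b : ℕ → ℝ) (d : ℕ) : ℝ := b (d + 1) + w (d + 1) * (b (d + 2) - b (d + 1))

/-- The first end always raises the degree of `n + 1`; the second end raises it again (a loop) or
raises one older degree. -/
theorem degreeSum_addEdge {n u : ℕ} (a b : ℕ → ℝ) (c : ℝ) (g : MultiGraph)
    (hu : u ∈ Finset.Icc 1 (n + 1)) :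
    degreeSum n a b c (g.addEdge (n + 1) u) = degreeSum n a (fun d => b (d + 1)) c g +
      if u = n + 1 then b (g.degree (n + 1) + 2) - b (g.degree (n + 1) + 1)
      else a (g.degree u + 1) - a (g.degree u) := by
  rw [Finset.mem_Icc] at hu
  unfold degreeSum
  split_ifs with h
  · subst h
    have h1 : ∀ v ∈ Finset.Icc 1 n,
        a ((g.addEdge (n + 1) (n + 1)).degree v) = a (g.degree v) := by
      intro v hv
      rw [Finset.mem_Icc] at hv
      rw [MultiGraph.degree_addEdge, if_neg (by omega)]
      rfl
    rw [Finset.sum_congr rfl h1, MultiGraph.degree_addEdge, if_pos rfl]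
    ring
  · have h1 : ∀ v ∈ Finset.Icc 1 n, a ((g.addEdge (n + 1) u).degree v) =
        a (g.degree v) + if v = u then a (g.degree u + 1) - a (g.degree u) else 0 := by
      intro v hv
      rw [Finset.mem_Icc] at hv
      rw [MultiGraph.degree_addEdge, if_neg (by omega)]
      split_ifs with h2
      · subst h2; simp
      · simp
    rw [Finset.sum_congr rfl h1, MultiGraph.degree_addEdge, if_pos rfl,
      if_neg (fun h' => h h'.symm), Finset.sum_add_distrib, Finset.sum_ite_eq',
      if_pos (Finset.mem_Icc.2 (by omega))]
    ring

/-- The former newest vertex becomes an old one and takes the weight `a`; the arriving vertex has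
degree 0 and adds the constant `b 0`. -/
theorem degreeSum_addVertex {m n : ℕ} {g : MultiGraph} (hg : IsBAState m n (m + 1) g)
    (a b : ℕ → ℝ) (c : ℝ) :
    degreeSum (n + 1) a b c g.addVertex = degreeSum n a a (c + b 0) g := by
  unfold degreeSum
  simp only [MultiGraph.degree_addVertex]
  rw [Finset.sum_Icc_succ_top (by omega), hg.degree_eq_zero (v := n + 1 + 1) (by omega)]
  ring

/-- The chance to hit a vertex depends on its own degree only, so additivity is preserved.
Prescribing `w` only for `d ≤ D`, where the degrees lie, leaves room for a truncation. -/
theorem IsBAState.baEdgeOp_degreeSum {m n i : ℕ} {g : MultiGraph} (hg : IsBAState m n i g)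
    (hi : 1 ≤ i) (a b : ℕ → ℝ) (c : ℝ) {w : ℕ → ℝ}
    (hw : ∀ d : ℕ, (d : ℝ) ≤ baDenom m n i → w d = d / baDenom m n i) :
    baEdgeOp m n i (degreeSum n a b c) g =
      degreeSum n (oldVertexOp w a) (newVertexOp w b) c g := by
  have hdeg : ∀ v ∈ Finset.Icc 1 (n + 1), (g.degree v : ℝ) + 1 ≤ baDenom m n i := by
    intro v hv
    have h1 : ((g.degree v : ℕ) : ℝ) + 2 ≤ 2 * ((m : ℝ) * n + i) := by
      exact_mod_cast hg.degree_add_two_le hv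
    unfold baDenom
    linarith
  unfold baEdgeOp
  rw [Finset.sum_congr rfl fun v hv => by rw [degreeSum_addEdge a b c g hv, mul_add],
    Finset.sum_add_distrib, ← Finset.sum_mul, hg.sum_baAttachProb hi, one_mul,
    Finset.sum_Icc_succ_top (by omega)]
  simp only [degreeSum, oldVertexOp, newVertexOp, Finset.sum_add_distrib, if_true]
  have h1 : ∀ v ∈ Finset.Icc 1 n, (baAttachProb m n (i + 1) g v * if v = n + 1 then
      b (g.degree (n + 1) + 2) - b (g.degree (n + 1) + 1) else
        a (g.degree v + 1) - a (g.degree v)) =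
      w (g.degree v) * (a (g.degree v + 1) - a (g.degree v)) := by
    intro v hv
    rw [Finset.mem_Icc] at hv
    have hne : v ≠ n + 1 := by omega
    rw [baAttachProb_succ, if_neg hne, if_neg hne, hw]
    have := hdeg v (Finset.mem_Icc.2 (by omega))
    linarith
  rw [Finset.sum_congr rfl h1, baAttachProb_succ, if_pos rfl, hw (g.degree (n + 1) + 1)]
  · push_cast; ring
  · push_cast; exact hdeg _ (by simp)

/-! ### Exponential moments -/

/-- Hoeffding's lemma: on `[-2, 2]` the exponential lies below its chord, the linear part of the
chord averages to zero, and `cosh (2 θ) ≤ exp (2 θ²)`. -/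
theorem sum_mul_exp_le {ι : Type*} (s : Finset ι) (p x : ι → ℝ) (hp : ∀ u ∈ s, 0 ≤ p u)
    (hp1 : ∑ u ∈ s, p u = 1) {y : ℝ} (hy : ∑ u ∈ s, p u * x u = y)
    (hxy : ∀ u ∈ s, |x u - y| ≤ 2) (θ : ℝ) :
    ∑ u ∈ s, p u * Real.exp (θ * x u) ≤ Real.exp (2 * θ ^ 2) * Real.exp (θ * y) := by
  have h1 : ∀ u ∈ s, p u * Real.exp (θ * x u) ≤ Real.exp (θ * y) *
      (p u * Real.cosh (2 * θ) + (p u * x u - p u * y) * (Real.sinh (2 * θ) / 2)) := by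
    intro u hu
    have hb := abs_le.1 (hxy u hu)
    have hc := convexOn_exp.2 (Set.mem_univ (2 * θ)) (Set.mem_univ (-(2 * θ)))
      (show 0 ≤ (1 + (x u - y) / 2) / 2 by linarith) (show 0 ≤ (1 - (x u - y) / 2) / 2 by linarith)
      (by ring)
    simp only [smul_eq_mul] at hc
    have hexp : (1 + (x u - y) / 2) / 2 * (2 * θ) + (1 - (x u - y) / 2) / 2 * -(2 * θ) =
        θ * (x u - y) := by ring
    rw [hexp] at hc
    have h2 : Real.exp (θ * x u) = Real.exp (θ * y) * Real.exp (θ * (x u - y)) := by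
      rw [← Real.exp_add]; ring_nf
    rw [h2, Real.cosh_eq, Real.sinh_eq]
    have h3 := mul_le_mul_of_nonneg_left hc (mul_nonneg (hp u hu) (Real.exp_pos (θ * y)).le)
    refine le_trans (le_of_eq ?_) (h3.trans (le_of_eq ?_)) <;> ring
  refine (Finset.sum_le_sum h1).trans ?_
  rw [← Finset.mul_sum, Finset.sum_add_distrib, ← Finset.sum_mul, ← Finset.sum_mul,
    Finset.sum_sub_distrib, ← Finset.sum_mul, hp1, hy, one_mul, one_mul, sub_self, zero_mul,
    add_zero, mul_comm]
  refine mul_le_mul_of_nonneg_right ?_ (Real.exp_pos _).le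
  refine (Real.cosh_le_exp_half_sq _).trans (Real.exp_le_exp.2 (le_of_eq ?_))
  ring

theorem IsBAState.baEdgeOp_exp_le {m n i : ℕ} {g : MultiGraph} (hg : IsBAState m n i g)
    (hi : 1 ≤ i) {a b : ℕ → ℝ} (ha : ∀ d, a d ∈ Set.Icc 0 1) (hb : ∀ d, b d ∈ Set.Icc 0 1)
    (c θ : ℝ) :
    baEdgeOp m n i (fun g => Real.exp (θ * degreeSum n a b c g)) g ≤
      Real.exp (2 * θ ^ 2) * Real.exp (θ * baEdgeOp m n i (degreeSum n a b c) g) := by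
  refine sum_mul_exp_le _ _ _ (fun u _ => baAttachProb_nonneg m n hi g u)
    (hg.sum_baAttachProb hi) rfl ?_ θ
  -- A reference value common to all choices of the second end: every outcome, hence also the mean,
  -- is within 1 of `B`, so outcomes are within 2 of the mean.
  set B := degreeSum n a (fun d => b (d + 1)) c g with hB
  have hbound : ∀ u ∈ Finset.Icc 1 (n + 1),
      |degreeSum n a b c (g.addEdge (n + 1) u) - B| ≤ 1 := by
    intro u hu
    rw [degreeSum_addEdge a b c g hu, add_sub_cancel_left, abs_le]
    split_ifs
    · have h1 := hb (g.degree (n + 1) + 2)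
      have h2 := hb (g.degree (n + 1) + 1)
      constructor <;> linarith [h1.1, h1.2, h2.1, h2.2]
    · have h1 := ha (g.degree u + 1)
      have h2 := ha (g.degree u)
      constructor <;> linarith [h1.1, h1.2, h2.1, h2.2]
  have hmean : |baEdgeOp m n i (degreeSum n a b c) g - B| ≤ 1 := by
    have h1 : baEdgeOp m n i (degreeSum n a b c) g - B =
        ∑ v ∈ Finset.Icc 1 (n + 1), baAttachProb m n (i + 1) g v *
          (degreeSum n a b c (g.addEdge (n + 1) v) - B) := by
      simp only [mul_sub, Finset.sum_sub_distrib, ← Finset.sum_mul, hg.sum_baAttachProb hi,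
        one_mul, baEdgeOp]
    rw [h1, ← hg.sum_baAttachProb hi]
    refine (Finset.abs_sum_le_sum_abs _ _).trans (Finset.sum_le_sum fun v hv => ?_)
    rw [abs_mul, abs_of_nonneg (baAttachProb_nonneg m n hi g v)]
    exact mul_le_of_le_one_right (baAttachProb_nonneg m n hi g v) (hbound v hv)
  intro u hu
  have h1 := abs_le.1 (hbound u hu)
  have h2 := abs_le.1 hmean
  unfold baEdgeOp at h2
  rw [abs_le]
  constructor <;> linarith [h1.1, h1.2, h2.1, h2.2]

/-- The attachment weight `d / D`, truncated at `1`. -/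
noncomputable def truncWeight (D : ℝ) (d : ℕ) : ℝ := min (d / D) 1

theorem truncWeight_of_le {D : ℝ} (hD : 1 ≤ D) {d : ℕ} (hd : (d : ℝ) ≤ D) :
    truncWeight D d = d / D :=
  min_eq_left ((div_le_one (by linarith)).2 hd)

theorem truncWeight_mem {D : ℝ} (hD : 1 ≤ D) (d : ℕ) : truncWeight D d ∈ Set.Icc 0 1 :=
  ⟨le_min (by positivity) zero_le_one, min_le_right _ _⟩

theorem add_mul_sub_mem_Icc {w x y : ℝ} (hw : w ∈ Set.Icc (0 : ℝ) 1) (hx : x ∈ Set.Icc (0 : ℝ) 1)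
    (hy : y ∈ Set.Icc (0 : ℝ) 1) : x + w * (y - x) ∈ Set.Icc (0 : ℝ) 1 := by
  obtain ⟨h1, h2⟩ := hw
  obtain ⟨h3, h4⟩ := hx
  obtain ⟨h5, h6⟩ := hy
  constructor
  · nlinarith [mul_nonneg h1 h5, mul_nonneg (sub_nonneg.2 h2) h3]
  · nlinarith [mul_nonneg h1 (sub_nonneg.2 h6), mul_nonneg (sub_nonneg.2 h2) (sub_nonneg.2 h4)]

/-! ### Azuma's inequality along the process. -/

namespace IsBAProcess

variable {Ω : Type*} [MeasurableSpace Ω] {P : Measure Ω} {m : ℕ} {G : ℕ → Ω → MultiGraph}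

theorem integral_degreeSum_edge_step [IsFiniteMeasure P] (hG : IsBAProcess P m G) {n i : ℕ}
    (hi : 1 ≤ i) (him : i ≤ m) (a b : ℕ → ℝ) (c : ℝ) {w : ℕ → ℝ}
    (hw : ∀ d : ℕ, (d : ℝ) ≤ baDenom m n i → w d = d / baDenom m n i) :
    ∫ ω, degreeSum n a b c (G (n * (m + 1) + (i + 1)) ω) ∂P =
      ∫ ω, degreeSum n (oldVertexOp w a) (newVertexOp w b) c (G (n * (m + 1) + i) ω) ∂P := by
  rw [hG.integral_edge_step hi him]
  refine integral_congr_ae ?_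
  filter_upwards [hG.ae_isBAState hi (by omega)] with ω hω
  exact hω.baEdgeOp_degreeSum hi a b c hw

theorem integral_degreeSum_vertex_step [IsFiniteMeasure P] (hG : IsBAProcess P m G) (n : ℕ)
    (a b : ℕ → ℝ) (c : ℝ) :
    ∫ ω, degreeSum (n + 1) a b c (G ((n + 1) * (m + 1) + 1) ω) ∂P =
      ∫ ω, degreeSum n a a (c + b 0) (G (n * (m + 1) + (m + 1)) ω) ∂P := by
  rw [hG.integral_vertex_step]
  refine integral_congr_ae ?_
  filter_upwards [hG.ae_isBAState (n := n) (i := m + 1) (by omega) le_rfl] with ω hω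
  exact degreeSum_addVertex hω a b c

/-- Azuma's bound for the exponential moments of additive functionals of the degrees. -/
theorem integral_exp_degreeSum_le [IsProbabilityMeasure P] (hG : IsBAProcess P m G) (θ : ℝ) :
    ∀ n i, 1 ≤ i → i ≤ m + 1 → ∀ a b : ℕ → ℝ, (∀ d, a d ∈ Set.Icc 0 1) →
      (∀ d, b d ∈ Set.Icc 0 1) → ∀ c : ℝ,
      ∫ ω, Real.exp (θ * degreeSum n a b c (G (n * (m + 1) + i) ω)) ∂P ≤
        Real.exp (2 * θ ^ 2 * ((m : ℝ) * n + i - 1)) *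
          Real.exp (θ * ∫ ω, degreeSum n a b c (G (n * (m + 1) + i) ω) ∂P) := by
  refine ba_induction m ?_ ?_ ?_
  · intro a b _ _ c
    have h1 : ∀ h : MultiGraph → ℝ, ∫ ω, h (G (0 * (m + 1) + 1) ω) ∂P = h ⟨1, 0⟩ := by
      intro h
      rw [zero_mul, zero_add, integral_congr_ae (hG.initial.mono fun ω hω => congrArg h hω)]
      simp
    rw [h1 fun g => Real.exp (θ * degreeSum 0 a b c g), h1]
    simp
  · intro n ih a b ha hb c
    rw [hG.integral_degreeSum_vertex_step, hG.integral_vertex_step n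
      fun g => Real.exp (θ * degreeSum (n + 1) a b c g)]
    refine le_trans (le_of_eq (integral_congr_ae ?_))
      ((ih a a ha ha (c + b 0)).trans (le_of_eq ?_))
    · filter_upwards [hG.ae_isBAState (n := n) (i := m + 1) (by omega) le_rfl] with ω hω
      rw [degreeSum_addVertex hω]
    · push_cast; ring_nf
  · intro n i hi him ih a b ha hb c
    have hD := one_le_baDenom m n hi
    -- The truncation keeps the transformed weights in `[0, 1]` at every degree, as the induction
    -- hypothesis demands, and changes nothing at degrees that occur.
    have hw := fun d => truncWeight_of_le hD (d := d)
    have hw1 := truncWeight_mem hD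
    rw [hG.integral_degreeSum_edge_step hi him a b c hw,
      hG.integral_edge_step hi him fun g => Real.exp (θ * degreeSum n a b c g)]
    have h1 := ih (oldVertexOp (truncWeight (baDenom m n i)) a)
      (newVertexOp (truncWeight (baDenom m n i)) b)
      (fun d => add_mul_sub_mem_Icc (hw1 _) (ha _) (ha _))
      (fun d => add_mul_sub_mem_Icc (hw1 _) (hb _) (hb _)) c
    calc _ ≤ ∫ ω, Real.exp (2 * θ ^ 2) * Real.exp (θ * degreeSum n
            (oldVertexOp (truncWeight (baDenom m n i)) a)
            (newVertexOp (truncWeight (baDenom m n i)) b) c (G (n * (m + 1) + i) ω)) ∂P := by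
          refine integral_mono_ae (hG.integrable hi (by omega) _) (hG.integrable hi (by omega)
            fun g => Real.exp (2 * θ ^ 2) * Real.exp (θ * degreeSum n
            (oldVertexOp (truncWeight (baDenom m n i)) a)
            (newVertexOp (truncWeight (baDenom m n i)) b) c g)) ?_
          filter_upwards [hG.ae_isBAState (n := n) hi (by omega)] with ω hω
          have := hω.baEdgeOp_exp_le hi ha hb c θ
          rwa [hω.baEdgeOp_degreeSum hi a b c hw] at this
      _ ≤ _ := by
          rw [integral_const_mul]
          refine (mul_le_mul_of_nonneg_left h1 (Real.exp_pos _).le).trans (le_of_eq ?_)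
          rw [← mul_assoc, ← Real.exp_add]
          push_cast
          ring_nf

end IsBAProcess

/-! ### The limit law and the recursion for the expected degree counts -/

/-- The flux into state `k` of a linear birth process with unit rate and occupation numbers `f`. -/
def birthFlux (f : ℕ → ℝ) : ℕ → ℝ
  | 0 => 0
  | k + 1 => k * f k

/-- The limiting degree distribution: `p k = (1_{k = m} + (k - 1) / 2 * p (k - 1)) / (1 + k / 2)`. -/
noncomputable def limitLaw (m : ℕ) : ℕ → ℝ
  | 0 => 0
  | k + 1 => ((if k + 1 = m then 1 else 0) + k * limitLaw m k / 2) / (1 + ((k + 1 : ℕ) : ℝ) / 2)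

theorem limitLaw_eq {m : ℕ} (hm : 1 ≤ m) (k : ℕ) :
    limitLaw m k = ((if k = m then 1 else 0) + birthFlux (limitLaw m) k / 2) / (1 + (k : ℝ) / 2) := by
  cases k with
  | zero => rw [if_neg (by omega)]; simp [limitLaw, birthFlux]
  | succ k => simp [limitLaw, birthFlux]

theorem tendsto_birthFlux {α : Type*} {l : Filter α} {f : α → ℕ → ℝ} {g : ℕ → ℝ} {k : ℕ}
    (h : ∀ j < k, Tendsto (fun x => f x j) l (𝓝 (g j))) :
    Tendsto (fun x => birthFlux (f x) k) l (𝓝 (birthFlux g k)) := by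
  cases k with
  | zero => exact tendsto_const_nhds
  | succ k => exact (h k (by omega)).const_mul _

/-- A linear recursion with asymptotic damping `c / n` has linear growth. -/
theorem tendsto_div_of_damped_recursion {E r : ℕ → ℝ} {c ρ : ℝ} (hc : 0 ≤ c)
    (hr : Tendsto r atTop (𝓝 ρ)) (hE : ∀ n, 1 ≤ n → E (n + 1) = E n * (1 - c / n) + r n) :
    Tendsto (fun n => E n / n) atTop (𝓝 (ρ / (1 + c))) := by
  set L := ρ / (1 + c) with hL
  have hLc : L * (1 + c) = ρ := div_mul_cancel₀ _ (by positivity)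
  -- Since `L (1 + c) = ρ`, the profile `n L` solves the recursion with `r` replaced by `ρ`. The
  -- deviation `F` is multiplied by a factor in `[0, 1]` once `n > c` and perturbed by `r n - ρ`,
  -- whose absolute sums are `o(n)` by Cesàro.
  set F : ℕ → ℝ := fun n => E n - n * L with hF
  obtain ⟨n₀, hn₀⟩ := exists_nat_gt (max c 1)
  have hstep : ∀ n, n₀ ≤ n → |F (n + 1)| ≤ |F n| + |r n - ρ| := by
    intro n hn
    have h1 : max c 1 < n := hn₀.trans_le (by exact_mod_cast hn)
    have hc' : c < n := (le_max_left _ _).trans_lt h1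
    have h1' : (1 : ℝ) < n := (le_max_right _ _).trans_lt h1
    have h2 : F (n + 1) = F n * (1 - c / n) + (r n - ρ) := by
      simp only [hF]
      rw [hE n (by exact_mod_cast h1'.le), ← hLc]
      have : (n : ℝ) ≠ 0 := by linarith
      push_cast
      field_simp
      ring
    rw [h2]
    refine (abs_add_le _ _).trans (add_le_add ?_ le_rfl)
    rw [abs_mul]
    refine mul_le_of_le_one_right (abs_nonneg _) ?_
    have h3 : c / n ≤ 1 := (div_le_one (by linarith)).2 hc'.le
    have h4 : 0 ≤ c / n := by positivity
    rw [abs_le]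
    constructor <;> linarith
  have hbound : ∀ n, n₀ ≤ n → |F n| ≤ |F n₀| + ∑ i ∈ Finset.range n, |r i - ρ| := by
    intro n hn
    induction n, hn using Nat.le_induction with
    | base =>
      have : 0 ≤ ∑ i ∈ Finset.range n₀, |r i - ρ| := Finset.sum_nonneg fun _ _ => abs_nonneg _
      linarith
    | succ n hn ih =>
      rw [Finset.sum_range_succ]
      linarith [hstep n hn]
  have hces : Tendsto (fun n : ℕ => |F n₀| / n + (n : ℝ)⁻¹ * ∑ i ∈ Finset.range n, |r i - ρ|) atTop
      (𝓝 0) := by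
    have h1 : Tendsto (fun n => |r n - ρ|) atTop (𝓝 0) := by
      simpa using (hr.sub_const ρ).abs
    simpa using (tendsto_const_div_atTop_nhds_zero_nat |F n₀|).add h1.cesaro
  have h0 : Tendsto (fun n : ℕ => F n / n) atTop (𝓝 0) := by
    refine squeeze_zero_norm' ?_ hces
    filter_upwards [eventually_ge_atTop n₀] with n hn
    rw [norm_div, Real.norm_eq_abs, Real.norm_natCast]
    calc |F n| / n ≤ (|F n₀| + ∑ i ∈ Finset.range n, |r i - ρ|) / n := by
          gcongr; exact hbound n hn
      _ = _ := by ring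
  have h1 := h0.add_const L
  rw [zero_add] at h1
  refine h1.congr' ?_
  filter_upwards [eventually_ge_atTop 1] with n hn
  have : (n : ℝ) ≠ 0 := by positivity
  simp only [hF]
  field_simp
  ring

/-- The indicator of the value `k`. -/
def valueIndicator (k d : ℕ) : ℝ := if d = k then 1 else 0

theorem valueIndicator_mem_Icc (k d : ℕ) : valueIndicator k d ∈ Set.Icc (0 : ℝ) 1 := by
  unfold valueIndicator
  split_ifs <;> simp

/-- A vertex of degree `k` leaves the class with weight `k / D`, and one of degree `k - 1` enters it
with weight `(k - 1) / D`. -/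
theorem oldVertexOp_valueIndicator (D : ℝ) (k d : ℕ) :
    oldVertexOp (fun d => d / D) (valueIndicator k) d =
      (1 - k / D) * valueIndicator k d + birthFlux (fun j => valueIndicator j d) k / D := by
  unfold oldVertexOp valueIndicator
  cases k with
  | zero =>
    by_cases h : d = 0 <;> simp [h, birthFlux]
  | succ k =>
    simp only [birthFlux, add_left_inj]
    by_cases h : d = k
    · subst h; simp
    · by_cases h' : d = k + 1
      · subst h'; simp; ring
      · simp [h, h']

theorem degreeSum_oldVertexOp_valueIndicator (n k : ℕ) (D : ℝ) (g : MultiGraph) :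
    degreeSum n (oldVertexOp (fun d => d / D) (valueIndicator k))
        (newVertexOp (fun d => d / D) 0) 0 g =
      (1 - k / D) * degreeSum n (valueIndicator k) 0 0 g +
        birthFlux (fun j => degreeSum n (valueIndicator j) 0 0 g) k / D := by
  simp only [degreeSum, oldVertexOp_valueIndicator, newVertexOp, Finset.sum_add_distrib,
    ← Finset.mul_sum, ← Finset.sum_div, Pi.zero_apply, sub_zero, mul_zero, add_zero]
  cases k with
  | zero => simp [birthFlux]
  | succ k => simp [birthFlux, Finset.mul_sum]

theorem IsBAState.degreeCount_eq {m n i : ℕ} {g : MultiGraph} (hg : IsBAState m n i g) (k : ℕ) :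
    (g.degreeCount k : ℝ) = degreeSum n (valueIndicator k) (valueIndicator k) 0 g := by
  rw [degreeSum, add_zero, ← Finset.sum_Icc_succ_top (f := fun v => valueIndicator k (g.degree v))
    (by omega), MultiGraph.degreeCount, MultiGraph.vertices, hg.numVertices, Finset.card_filter]
  push_cast
  rfl

/-! ### Asymptotics of the expected degree counts. -/

namespace IsBAProcess

variable {Ω : Type*} [MeasurableSpace Ω] {P : Measure Ω} {m : ℕ} {G : ℕ → Ω → MultiGraph}

/-- The expected number of vertices of degree `k` among the first `n` vertices at time
`n (m + 1) + i`. -/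
noncomputable def expOldCount (P : Measure Ω) (G : ℕ → Ω → MultiGraph) (m k n i : ℕ) : ℝ :=
  ∫ ω, degreeSum n (valueIndicator k) 0 0 (G (n * (m + 1) + i) ω) ∂P

theorem expOldCount_mem_Icc [IsProbabilityMeasure P] (hG : IsBAProcess P m G) (k n : ℕ) {i : ℕ}
    (hi : 1 ≤ i) (him : i ≤ m + 1) : expOldCount P G m k n i ∈ Set.Icc (0 : ℝ) n := by
  have h1 : ∀ g, degreeSum n (valueIndicator k) 0 0 g ∈ Set.Icc (0 : ℝ) n := by
    intro g
    simp only [degreeSum, Pi.zero_apply, add_zero]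
    refine ⟨Finset.sum_nonneg fun v _ => (valueIndicator_mem_Icc k _).1, ?_⟩
    refine (Finset.sum_le_sum fun v _ => (valueIndicator_mem_Icc k _).2).trans ?_
    simp
  refine ⟨integral_nonneg fun ω => (h1 _).1, ?_⟩
  refine (integral_mono (hG.integrable hi him _) (integrable_const (n : ℝ))
    fun ω => (h1 _).2).trans ?_
  simp

theorem expOldCount_succ [IsFiniteMeasure P] (hG : IsBAProcess P m G) (k : ℕ) {n i : ℕ}
    (hi : 1 ≤ i) (him : i ≤ m) :
    expOldCount P G m k n (i + 1) = (1 - k / baDenom m n i) * expOldCount P G m k n i +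
      birthFlux (fun j => expOldCount P G m j n i) k / baDenom m n i := by
  unfold expOldCount
  rw [hG.integral_degreeSum_edge_step hi him _ _ _ (w := fun d => d / baDenom m n i)
    fun _ _ => rfl]
  simp only [degreeSum_oldVertexOp_valueIndicator]
  rw [integral_add ((hG.integrable hi (by omega) _).const_mul _)
    ((hG.integrable hi (by omega)
      fun g => birthFlux (fun j => degreeSum n (valueIndicator j) 0 0 g) k).div_const _),
    integral_const_mul, integral_div]
  congr 2
  cases k with
  | zero => simp [birthFlux]
  | succ k => simp only [birthFlux]; rw [integral_const_mul]

/-- The newest vertex has degree `i - 1` after `i - 1` steps unless there was a loop. -/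
theorem integral_newVertex_le [IsFiniteMeasure P] (hG : IsBAProcess P m G) {n : ℕ} (hn : 1 ≤ n) :
    ∀ i, 1 ≤ i → i ≤ m + 1 →
      ∫ ω, degreeSum n 0 (fun d => if d + 1 = i then 0 else 1) 0 (G (n * (m + 1) + i) ω) ∂P ≤
        P.real Set.univ * (m * (i - 1) / n) := by
  intro i hi
  induction i, hi using Nat.le_induction with
  | base =>
    intro _
    obtain ⟨n, rfl⟩ : ∃ n', n = n' + 1 := ⟨n - 1, by omega⟩
    rw [hG.integral_degreeSum_vertex_step]
    simp [degreeSum]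
  | succ i hi ih =>
    intro him
    rw [hG.integral_degreeSum_edge_step hi (by omega) _ _ _ (w := fun d => d / baDenom m n i)
      fun _ _ => rfl]
    have hD : (n : ℝ) ≤ baDenom m n i := by
      have h1 : (1 : ℝ) ≤ i := by exact_mod_cast hi
      have h2 : (1 : ℝ) ≤ m := by exact_mod_cast (show 1 ≤ m by omega)
      have h3 : (0 : ℝ) ≤ n := by positivity
      unfold baDenom
      nlinarith
    have hn' : (0 : ℝ) < n := by exact_mod_cast hn
    have hpt : ∀ g, degreeSum n (oldVertexOp (fun d => d / baDenom m n i) 0)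
        (newVertexOp (fun d => d / baDenom m n i) fun d => if d + 1 = i + 1 then 0 else 1) 0 g ≤
        degreeSum n 0 (fun d => if d + 1 = i then 0 else 1) 0 g + m / n := by
      intro g
      have hmn : (0 : ℝ) ≤ m / n := by positivity
      simp only [degreeSum, oldVertexOp, newVertexOp, Pi.zero_apply, sub_self, mul_zero, add_zero,
        Finset.sum_const_zero, zero_add, add_left_inj]
      set d := g.degree (n + 1)
      -- If the degree was as expected, only a loop spoils it, with weight `i / D ≤ m / n`;
      -- otherwise the failure indicator is already 1 and averaging cannot raise it.
      by_cases h1 : d + 1 = i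
      · rw [if_pos h1, if_neg (by omega), h1]
        have h2 : (i : ℝ) / baDenom m n i ≤ m / n := by
          have : (i : ℝ) ≤ m := by exact_mod_cast (show i ≤ m by omega)
          gcongr
        linarith
      · rw [if_neg h1]
        have h2 : (0 : ℝ) ≤ ((d + 1 : ℕ) : ℝ) / baDenom m n i :=
          div_nonneg (by positivity) (by linarith)
        have h3 : (if d + 2 = i then (0 : ℝ) else 1) - 1 ≤ 0 := by split_ifs <;> norm_num
        linarith [mul_nonpos_of_nonneg_of_nonpos h2 h3]
    refine (integral_mono (hG.integrable hi (by omega) _) (hG.integrable hi (by omega)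
      fun g => degreeSum n 0 (fun d => if d + 1 = i then 0 else 1) 0 g + m / n)
      fun ω => hpt _).trans ?_
    rw [integral_add (hG.integrable hi (by omega) _) (integrable_const _), integral_const,
      smul_eq_mul]
    refine (add_le_add (ih (by omega)) le_rfl).trans (le_of_eq ?_)
    push_cast
    ring

theorem expOldCount_next [IsFiniteMeasure P] (hG : IsBAProcess P m G) (k n : ℕ) :
    expOldCount P G m k (n + 1) 1 = expOldCount P G m k n (m + 1) +
      ∫ ω, degreeSum n 0 (valueIndicator k) 0 (G (n * (m + 1) + (m + 1)) ω) ∂P := by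
  unfold expOldCount
  rw [hG.integral_degreeSum_vertex_step, ← integral_add (hG.integrable (by omega) le_rfl _)
    (hG.integrable (by omega) le_rfl _)]
  simp [degreeSum]

/-- The vertices present at the end of a block are exactly the old vertices at the start of the next
one. -/
theorem integral_degreeCount [IsFiniteMeasure P] (hG : IsBAProcess P m G) (k n : ℕ) :
    ∫ ω, ((G ((n + 1) * (m + 1)) ω).degreeCount k : ℝ) ∂P = expOldCount P G m k (n + 1) 1 := by
  unfold expOldCount
  rw [hG.integral_degreeSum_vertex_step, show (n + 1) * (m + 1) = n * (m + 1) + (m + 1) by ring]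
  refine integral_congr_ae ?_
  filter_upwards [hG.ae_isBAState (n := n) (i := m + 1) (by omega) le_rfl] with ω hω
  rw [hω.degreeCount_eq]
  simp

/-- The newest vertex has degree `m` with probability tending to one. -/
theorem tendsto_integral_newVertex [IsProbabilityMeasure P] (hG : IsBAProcess P m G) (k : ℕ) :
    Tendsto (fun n => ∫ ω, degreeSum n 0 (valueIndicator k) 0 (G (n * (m + 1) + (m + 1)) ω) ∂P)
      atTop (𝓝 (if k = m then 1 else 0)) := by
  rw [tendsto_iff_norm_sub_tendsto_zero]
  refine squeeze_zero' (Eventually.of_forall fun _ => norm_nonneg _) ?_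
    (tendsto_const_div_atTop_nhds_zero_nat ((m : ℝ) * m))
  filter_upwards [eventually_ge_atTop 1] with n hn
  have h1 := hG.integral_newVertex_le hn (m + 1) (by omega) le_rfl
  have h2 : ∫ ω, degreeSum n 0 (valueIndicator k) 0 (G (n * (m + 1) + (m + 1)) ω) ∂P -
      (if k = m then 1 else 0) = ∫ ω, (degreeSum n 0 (valueIndicator k) 0
        (G (n * (m + 1) + (m + 1)) ω) - if k = m then 1 else 0) ∂P := by
    rw [integral_sub (hG.integrable (by omega) le_rfl _) (integrable_const _), integral_const]
    simp
  rw [h2]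
  refine (norm_integral_le_integral_norm _).trans (le_trans ?_ (h1.trans (le_of_eq ?_)))
  · refine integral_mono (hG.integrable (by omega) le_rfl fun g =>
      ‖degreeSum n 0 (valueIndicator k) 0 g - if k = m then 1 else 0‖)
      (hG.integrable (by omega) le_rfl _) fun ω => ?_
    simp only [degreeSum, Pi.zero_apply, Finset.sum_const_zero, zero_add, add_zero, valueIndicator,
      add_left_inj]
    by_cases h : (G (n * (m + 1) + (m + 1)) ω).degree (n + 1) = m
    · rw [if_pos h, h]
      by_cases h' : m = k <;> simp [h', eq_comm]
    · rw [if_neg h]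
      split_ifs <;> simp
  · simp

end IsBAProcess

theorem le_baDenom (m n : ℕ) {i : ℕ} (hm : 1 ≤ m) (hi : 1 ≤ i) : (n : ℝ) ≤ baDenom m n i := by
  have h1 : (1 : ℝ) ≤ i := by exact_mod_cast hi
  have h2 : (1 : ℝ) ≤ m := by exact_mod_cast hm
  have h3 : (0 : ℝ) ≤ n := by positivity
  unfold baDenom
  nlinarith

theorem birthFlux_mem_Icc {f : ℕ → ℝ} {c : ℝ} (hf : ∀ k, f k ∈ Set.Icc 0 c) (k : ℕ) :
    birthFlux f k ∈ Set.Icc 0 (k * c) := by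
  cases k with
  | zero => simp [birthFlux]
  | succ k =>
    have h1 := (hf k).1
    have h2 := (hf k).2
    simp only [birthFlux, Set.mem_Icc]
    push_cast
    constructor
    · positivity
    · have : (0 : ℝ) ≤ k := by positivity
      nlinarith

namespace IsBAProcess

variable {Ω : Type*} [MeasurableSpace Ω] {P : Measure Ω} {m : ℕ} {G : ℕ → Ω → MultiGraph}

/-- Each edge contributes a gain minus a loss, both in `[0, k]` because the counts are at most `n ≤
D`. -/
theorem abs_expOldCount_sub_le [IsProbabilityMeasure P] (hG : IsBAProcess P m G) (hm : 1 ≤ m)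
    (k : ℕ) {n : ℕ} (hn : 1 ≤ n) : ∀ i, 1 ≤ i → i ≤ m + 1 →
      |expOldCount P G m k n i - expOldCount P G m k n 1| ≤ k * (i - 1) := by
  intro i hi
  induction i, hi using Nat.le_induction with
  | base => intro _; simp
  | succ i hi ih =>
    intro him
    have hD := le_baDenom m n hm hi
    have hn' : (0 : ℝ) < n := by exact_mod_cast hn
    have hD0 := hn'.trans_le hD
    have hA := hG.expOldCount_mem_Icc k n hi (by omega)
    have hF := birthFlux_mem_Icc (fun j => hG.expOldCount_mem_Icc j n hi (by omega)) k
    have h1 : k / baDenom m n i * expOldCount P G m k n i ∈ Set.Icc (0 : ℝ) k := by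
      rw [div_mul_eq_mul_div]
      refine ⟨div_nonneg (mul_nonneg (by positivity) hA.1) hD0.le, ?_⟩
      rw [div_le_iff₀ hD0]
      exact mul_le_mul_of_nonneg_left (hA.2.trans hD) (by positivity)
    have h2 : birthFlux (fun j => expOldCount P G m j n i) k / baDenom m n i ∈
        Set.Icc (0 : ℝ) k := by
      refine ⟨div_nonneg hF.1 hD0.le, ?_⟩
      rw [div_le_iff₀ hD0]
      exact hF.2.trans (mul_le_mul_of_nonneg_left hD (by positivity))
    have h3 := abs_le.1 (ih (by omega))
    rw [hG.expOldCount_succ k hi (by omega), abs_le]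
    have h1a := h1.1
    have h1b := h1.2
    have h2a := h2.1
    have h2b := h2.2
    push_cast
    constructor <;> linarith [h3.1, h3.2]

/-- Within a block the count moves by `O(1)` and the denominator is `2 m n + O(1)`, so the position
`i` can be forgotten at cost `O(1 / n)`. -/
theorem tendsto_expOldCount_div_sub [IsProbabilityMeasure P] (hG : IsBAProcess P m G) (hm : 1 ≤ m)
    (k : ℕ) {i : ℕ} (hi : 1 ≤ i) (him : i ≤ m) :
    Tendsto (fun n => expOldCount P G m k n i / baDenom m n i -
      expOldCount P G m k n 1 / n / (2 * m)) atTop (𝓝 0) := by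
  rw [tendsto_zero_iff_norm_tendsto_zero]
  refine squeeze_zero' (Eventually.of_forall fun _ => norm_nonneg _) ?_
    (tendsto_const_div_atTop_nhds_zero_nat ((k : ℝ) * m + 1))
  filter_upwards [eventually_ge_atTop 1] with n hn
  have hD := le_baDenom m n hm hi
  have hn' : (0 : ℝ) < n := by exact_mod_cast hn
  have hm' : (0 : ℝ) < m := by exact_mod_cast hm
  have hD0 := hn'.trans_le hD
  have hi1 : (1 : ℝ) ≤ i := by exact_mod_cast hi
  have hi2 : (i : ℝ) ≤ m := by exact_mod_cast him
  have hE := hG.expOldCount_mem_Icc k n (i := 1) le_rfl (by omega)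
  have hA := hG.abs_expOldCount_sub_le hm k hn i hi (by omega)
  set A := expOldCount P G m k n i
  set E := expOldCount P G m k n 1
  -- Based on `2 m n - D = 1 - 2 i`.
  have h1 : A / baDenom m n i - E / n / (2 * m) =
      (A - E) / baDenom m n i + E / n * ((1 - 2 * i) / (2 * m * baDenom m n i)) := by
    field_simp
    unfold baDenom
    ring
  rw [h1, add_div]
  refine (norm_add_le _ _).trans (add_le_add ?_ ?_)
  · rw [norm_div, Real.norm_eq_abs, Real.norm_of_nonneg hD0.le]
    refine div_le_div₀ (by positivity) (hA.trans ?_) hn' hD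
    have : (0 : ℝ) ≤ k := by positivity
    nlinarith
  · have h2 : ‖E / n‖ ≤ 1 := by
      rw [Real.norm_of_nonneg (div_nonneg hE.1 hn'.le)]
      exact (div_le_one hn').2 hE.2
    rw [norm_mul, norm_div (1 - 2 * (i : ℝ)), Real.norm_of_nonneg (by positivity : 0 ≤ 2 * m * baDenom m n i)]
    refine (mul_le_of_le_one_left (by positivity) h2).trans ?_
    rw [Real.norm_eq_abs, div_le_div_iff₀ (by positivity) hn']
    have h3 : |1 - 2 * (i : ℝ)| ≤ 2 * m := by
      rw [abs_le]; constructor <;> linarith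
    rw [one_mul]
    exact mul_le_mul h3 hD hn'.le (by positivity)

theorem expOldCount_telescope [IsFiniteMeasure P] (hG : IsBAProcess P m G) (k n : ℕ) :
    expOldCount P G m k n (m + 1) = expOldCount P G m k n 1 +
      ∑ i ∈ Finset.Ico 1 (m + 1), (birthFlux (fun j => expOldCount P G m j n i) k / baDenom m n i -
        k * (expOldCount P G m k n i / baDenom m n i)) := by
  have h1 := Finset.sum_Ico_sub (fun i => expOldCount P G m k n i) (show 1 ≤ m + 1 by omega)
  rw [← sub_eq_iff_eq_add', ← h1]
  refine Finset.sum_congr rfl fun i hi => ?_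
  rw [Finset.mem_Ico] at hi
  rw [hG.expOldCount_succ k hi.1 (by omega)]
  ring

/-- The expected proportion of vertices of degree `k` converges. -/
theorem tendsto_expOldCount_div [IsProbabilityMeasure P] (hG : IsBAProcess P m G) (hm : 1 ≤ m)
    (k : ℕ) : Tendsto (fun n => expOldCount P G m k n 1 / n) atTop (𝓝 (limitLaw m k)) := by
  induction k using Nat.strong_induction_on with
  | _ k ih =>
  have hm' : (0 : ℝ) < m := by exact_mod_cast hm
  rw [limitLaw_eq hm]
  -- The loss over a block is the damping `c = k / 2` applied to the value at the start of the
  -- block, plus an error. This error, the gain from degree `k - 1` (known by induction) and the new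
  -- vertex form `r`.
  refine tendsto_div_of_damped_recursion
    (r := fun n => (∫ ω, degreeSum n 0 (valueIndicator k) 0 (G (n * (m + 1) + (m + 1)) ω) ∂P) +
      ∑ i ∈ Finset.Ico 1 (m + 1), (birthFlux (fun j => expOldCount P G m j n i / baDenom m n i) k -
        k * (expOldCount P G m k n i / baDenom m n i -
          expOldCount P G m k n 1 / n / (2 * m)))) (by positivity) ?_ ?_
  · have hsum : birthFlux (limitLaw m) k / 2 = ∑ _i ∈ Finset.Ico 1 (m + 1),
        (birthFlux (fun j => limitLaw m j / (2 * m)) k - k * 0) := by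
      simp only [mul_zero, sub_zero, Finset.sum_const, Nat.card_Ico, add_tsub_cancel_right,
        nsmul_eq_mul]
      cases k with
      | zero => simp [birthFlux]
      | succ k => simp only [birthFlux]; field_simp
    rw [hsum]
    refine (hG.tendsto_integral_newVertex k).add (tendsto_finsetSum _ fun i hi => ?_)
    rw [Finset.mem_Ico] at hi
    refine (tendsto_birthFlux fun j hj => ?_).sub
      ((hG.tendsto_expOldCount_div_sub hm k hi.1 (by omega)).const_mul _)
    have h1 := (hG.tendsto_expOldCount_div_sub hm j hi.1 (by omega)).add
      ((ih j hj).div_const (2 * m))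
    simpa using h1
  · intro n hn
    have hn' : (0 : ℝ) < n := by exact_mod_cast hn
    rw [hG.expOldCount_next, hG.expOldCount_telescope]
    have h1 : ∀ i ∈ Finset.Ico 1 (m + 1),
        (birthFlux (fun j => expOldCount P G m j n i) k / baDenom m n i -
          k * (expOldCount P G m k n i / baDenom m n i)) =
        (birthFlux (fun j => expOldCount P G m j n i / baDenom m n i) k -
          k * (expOldCount P G m k n i / baDenom m n i -
            expOldCount P G m k n 1 / n / (2 * m))) -
          k * expOldCount P G m k n 1 / n / (2 * m) := by
      intro i _
      have : birthFlux (fun j => expOldCount P G m j n i / baDenom m n i) k =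
          birthFlux (fun j => expOldCount P G m j n i) k / baDenom m n i := by
        cases k with
        | zero => simp [birthFlux]
        | succ k => simp only [birthFlux]; ring
      rw [this]; ring
    rw [Finset.sum_congr rfl h1, Finset.sum_sub_distrib]
    simp only [Finset.sum_const, Nat.card_Ico, add_tsub_cancel_right, nsmul_eq_mul]
    have h2 : (m : ℝ) * (k * expOldCount P G m k n 1 / n / (2 * m)) =
        expOldCount P G m k n 1 * (k / 2 / n) := by field_simp
    rw [h2, mul_sub, mul_one]
    abel

theorem tendsto_integral_degreeCount_div [IsProbabilityMeasure P] (hG : IsBAProcess P m G)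
    (hm : 1 ≤ m) (k : ℕ) :
    Tendsto (fun n : ℕ => (∫ ω, ((G (n * (m + 1)) ω).degreeCount k : ℝ) ∂P) / n) atTop
      (𝓝 (limitLaw m k)) := by
  refine (hG.tendsto_expOldCount_div hm k).congr' ?_
  filter_upwards [eventually_ge_atTop 1] with n hn
  obtain ⟨n, rfl⟩ : ∃ n', n = n' + 1 := ⟨n - 1, by omega⟩
  rw [hG.integral_degreeCount]

end IsBAProcess

/-! ### The degree of a uniform vertex and concentration of the counts. -/

namespace IsBAState

variable {m n i : ℕ} {g : MultiGraph}

/-- A degree is at most twice the number `m (n + 1)` of edges, which makes the maximum over `k` a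
finite one. -/
theorem degreeCount_eq_zero (hg : IsBAState m n (m + 1) g) {k : ℕ} (hk : 2 * (m * (n + 1)) < k) :
    g.degreeCount k = 0 := by
  rw [MultiGraph.degreeCount, Finset.card_eq_zero, Finset.filter_eq_empty_iff]
  intro v hv h
  rw [MultiGraph.vertices, hg.numVertices] at hv
  have := hg.degree_add_two_le hv
  rw [h] at this
  have h2 : m * (n + 1) = m * n + m := by ring
  omega

end IsBAState

namespace IsBAProcess

variable {Ω : Type*} [MeasurableSpace Ω] {P : Measure Ω} {m : ℕ} {G : ℕ → Ω → MultiGraph}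

theorem ae_isBAState_mul [IsFiniteMeasure P] (hG : IsBAProcess P m G) (n : ℕ) :
    ∀ᵐ ω ∂P, IsBAState m n (m + 1) (G ((n + 1) * (m + 1)) ω) := by
  rw [show (n + 1) * (m + 1) = n * (m + 1) + (m + 1) by ring]
  exact hG.ae_isBAState (by omega) le_rfl

/-- The degree of a uniformly chosen vertex has the law of the expected proportions. -/
theorem measureReal_degree_uniformVertex [IsFiniteMeasure P] (hG : IsBAProcess P m G)
    {V : ℕ → Ω → ℕ} (hV : IsUniformVertex P G V) (k n : ℕ) :
    P.real {ω | (G ((n + 1) * (m + 1)) ω).degree (V ((n + 1) * (m + 1)) ω) = k} =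
      (∫ ω, ((G ((n + 1) * (m + 1)) ω).degreeCount k : ℝ) ∂P) / (n + 1 : ℕ) := by
  obtain ⟨S, hS, hGS⟩ := hG.exists_finset n (m + 1) (by omega) le_rfl
  rw [show n * (m + 1) + (m + 1) = (n + 1) * (m + 1) by ring] at hGS
  have ht : 1 ≤ (n + 1) * (m + 1) := Nat.mul_pos (by omega) (by omega)
  set t := (n + 1) * (m + 1)
  have hVm : ∀ v, MeasurableSet {ω | V t ω = v} := fun v =>
    hV.measurable t (MeasurableSet.of_discrete (s := {v}))
  have hdm : ∀ g : MultiGraph, MeasurableSet {ω | g.degree (V t ω) = k} := fun g =>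
    hV.measurable t (MeasurableSet.of_discrete (s := {v | g.degree v = k}))
  have hm1 : MeasurableSet {ω | (G t ω).degree (V t ω) = k} :=
    ((hG.measurable t).prodMk (hV.measurable t))
      (MeasurableSet.of_discrete (s := {x : MultiGraph × ℕ | x.1.degree x.2 = k}))
  have hfib : ∀ g ∈ S, P.real ({ω | (G t ω).degree (V t ω) = k} ∩ {ω | G t ω = g}) =
      P.real {ω | G t ω = g} * (g.degreeCount k / (n + 1 : ℕ)) := by
    intro g hg
    have hnv := (hS g hg).numVertices
    have hu : ∀ v ∈ g.vertices, P.real ({ω | G t ω = g} ∩ {ω | V t ω = v}) =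
        P.real {ω | G t ω = g} / (n + 1 : ℕ) := by
      intro v hv
      have := hV.uniform t ht g v hv
      rwa [hnv] at this
    have hsum := hasSum_measureReal_inter_fiber P hVm (hG.measurableSet_eq t g)
    -- Only the masses at the vertices of `g` are prescribed; they already add up to the mass of `G
    -- t = g`, so nothing is left elsewhere.
    have hzero : ∀ v ∉ g.vertices, P.real ({ω | G t ω = g} ∩ {ω | V t ω = v}) = 0 := by
      intro v hv
      have h1 := sum_le_hasSum (insert v g.vertices) (fun _ _ => measureReal_nonneg) hsum
      rw [Finset.sum_insert hv, Finset.sum_congr rfl hu] at h1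
      simp only [MultiGraph.vertices, hnv, Finset.sum_const, Nat.card_Icc, add_tsub_cancel_right,
        nsmul_eq_mul] at h1
      rw [mul_div_cancel₀ _ (by positivity)] at h1
      exact le_antisymm (by linarith) measureReal_nonneg
    have hset : {ω | (G t ω).degree (V t ω) = k} ∩ {ω | G t ω = g} =
        {ω | G t ω = g} ∩ {ω | g.degree (V t ω) = k} := by
      ext ω
      simp only [Set.mem_inter_iff, Set.mem_ofPred_eq]
      constructor
      · rintro ⟨h1, rfl⟩; exact ⟨rfl, h1⟩
      · rintro ⟨rfl, h1⟩; exact ⟨h1, rfl⟩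
    have hsum' := hasSum_measureReal_inter_fiber P hVm ((hG.measurableSet_eq t g).inter (hdm g))
    have hval : ∀ v, P.real ({ω | G t ω = g} ∩ {ω | g.degree (V t ω) = k} ∩ {ω | V t ω = v}) =
        if g.degree v = k then P.real ({ω | G t ω = g} ∩ {ω | V t ω = v}) else 0 := by
      intro v
      split_ifs with h
      · congr 1
        ext ω
        simp only [Set.mem_inter_iff, Set.mem_ofPred_eq]
        constructor
        · rintro ⟨⟨h1, _⟩, h3⟩; exact ⟨h1, h3⟩
        · rintro ⟨h1, h3⟩; exact ⟨⟨h1, by rw [h3]; exact h⟩, h3⟩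
      · rw [show {ω | G t ω = g} ∩ {ω | g.degree (V t ω) = k} ∩ {ω | V t ω = v} = ∅ from ?_,
          measureReal_empty]
        ext ω
        simp only [Set.mem_inter_iff, Set.mem_ofPred_eq, Set.mem_empty_iff_false, iff_false]
        rintro ⟨⟨_, h1⟩, h3⟩
        exact h (by rw [← h3]; exact h1)
    simp only [hval] at hsum'
    rw [hset, hsum'.unique (hasSum_sum_of_ne_finset_zero (s := g.vertices) ?_),
      ← Finset.sum_filter, Finset.sum_congr rfl fun v hv => hu v (Finset.mem_filter.1 hv).1]
    · rw [Finset.sum_const, nsmul_eq_mul, MultiGraph.degreeCount]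
      ring
    · intro v hv
      rw [hzero v hv, ite_self]
  have hsum := hasSum_measureReal_inter_fiber P (hG.measurableSet_eq t) hm1
  rw [hsum.unique (hasSum_sum_of_ne_finset_zero (s := S) ?_), Finset.sum_congr rfl hfib,
    ← integral_div, integral_eq_sum_of_ae_mem_finset (hG.measurableSet_eq t) hGS
      fun g => (g.degreeCount k : ℝ) / (n + 1 : ℕ)]
  intro g hg
  rw [measureReal_eq_zero_iff]
  refine measure_mono_null Set.inter_subset_right (measure_eq_zero_iff_ae_notMem.2 ?_)
  filter_upwards [hGS] with ω h1 h2
  exact hg (h2 ▸ h1)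

/-- Each of the `m (n + 1)` edges costs a factor `exp (2 θ²) = exp (4 θ² / 2)`, whence the variance
proxy. -/
theorem hasSubgaussianMGF_degreeCount [IsProbabilityMeasure P] (hG : IsBAProcess P m G)
    (k n : ℕ) :
    HasSubgaussianMGF (fun ω => ((G ((n + 1) * (m + 1)) ω).degreeCount k : ℝ) -
      ∫ ω', ((G ((n + 1) * (m + 1)) ω').degreeCount k : ℝ) ∂P) (4 * (m * (n + 1 : ℕ)) : ℝ≥0) P where
  integrable_exp_mul θ := by
    rw [show (n + 1) * (m + 1) = n * (m + 1) + (m + 1) by ring]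
    exact hG.integrable (by omega) le_rfl fun g =>
      Real.exp (θ * ((g.degreeCount k : ℝ) - _))
  mgf_le θ := by
    have h := hG.integral_exp_degreeSum_le θ n (m + 1) (by omega) le_rfl (valueIndicator k)
      (valueIndicator k) (valueIndicator_mem_Icc k) (valueIndicator_mem_Icc k) 0
    have hst := hG.ae_isBAState_mul n
    rw [show n * (m + 1) + (m + 1) = (n + 1) * (m + 1) by ring,
      ← integral_congr_ae (hst.mono fun ω hω => hω.degreeCount_eq k),
      ← integral_congr_ae (hst.mono fun ω hω =>
        congrArg (fun x => Real.exp (θ * x)) (hω.degreeCount_eq k))] at h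
    set E := ∫ ω', ((G ((n + 1) * (m + 1)) ω').degreeCount k : ℝ) ∂P
    have h1 : mgf (fun ω => ((G ((n + 1) * (m + 1)) ω).degreeCount k : ℝ) - E) P θ =
        (∫ ω, Real.exp (θ * ((G ((n + 1) * (m + 1)) ω).degreeCount k : ℝ)) ∂P) *
          Real.exp (-(θ * E)) := by
      rw [mgf, ← integral_mul_const]
      refine integral_congr_ae (ae_of_all _ fun ω => ?_)
      simp only [← Real.exp_add]
      ring_nf
    rw [h1]
    refine (mul_le_mul_of_nonneg_right h (Real.exp_pos _).le).trans (le_of_eq ?_)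
    rw [← Real.exp_add, ← Real.exp_add]
    push_cast
    ring_nf

/-- Concentration of the degree counts. -/
theorem measureReal_abs_degreeCount_sub_ge_le [IsProbabilityMeasure P] (hG : IsBAProcess P m G)
    (k n : ℕ) {x : ℝ} (hx : 0 ≤ x) :
    P.real {ω | x ≤ |((G ((n + 1) * (m + 1)) ω).degreeCount k : ℝ) -
      ∫ ω', ((G ((n + 1) * (m + 1)) ω').degreeCount k : ℝ) ∂P|} ≤
        2 * Real.exp (-x ^ 2 / (8 * (m * (n + 1 : ℕ)))) := by
  have h := hG.hasSubgaussianMGF_degreeCount k n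
  have h1 := h.measure_ge_le hx
  have h2 := h.neg.measure_ge_le hx
  set Y := fun ω => ((G ((n + 1) * (m + 1)) ω).degreeCount k : ℝ) -
      ∫ ω', ((G ((n + 1) * (m + 1)) ω').degreeCount k : ℝ) ∂P with hY
  have hsub : {ω | x ≤ |Y ω|} ⊆ {ω | x ≤ Y ω} ∪ {ω | x ≤ (-Y) ω} := by
    intro ω hω
    simpa only [Set.mem_union, Set.mem_ofPred_eq, Pi.neg_apply, le_abs] using hω
  refine (measureReal_mono hsub).trans ((measureReal_union_le _ _).trans
    ((add_le_add h1 h2).trans (le_of_eq ?_)))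
  push_cast
  ring_nf

/-- Once the mean proportion is within `ε / 2` of its limit, a deviation `ε` from the limit forces a
deviation `ε / 2` from the mean, which is exponentially unlikely. -/
theorem tendstoInMeasure_degreeCount_div [IsProbabilityMeasure P] (hG : IsBAProcess P m G)
    (hm : 1 ≤ m) (k : ℕ) :
    TendstoInMeasure P (fun (n : ℕ) ω => ((G (n * (m + 1)) ω).degreeCount k : ℝ) / (n : ℝ)) atTop
      fun _ => limitLaw m k := by
  rw [tendstoInMeasure_iff_measureReal_norm]
  intro ε hε
  have hlim := hG.tendsto_integral_degreeCount_div hm k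
  have hm' : (0 : ℝ) < m := by exact_mod_cast hm
  have hexp : Tendsto (fun n : ℕ => 2 * Real.exp (-(n * (ε ^ 2 / (32 * m))))) atTop (𝓝 0) := by
    have h1 : Tendsto (fun n : ℕ => (n : ℝ) * (ε ^ 2 / (32 * m))) atTop atTop :=
      tendsto_natCast_atTop_atTop.atTop_mul_const (by positivity)
    simpa using ((Real.tendsto_exp_neg_atTop_nhds_zero.comp h1).const_mul 2)
  refine squeeze_zero' (Eventually.of_forall fun _ => measureReal_nonneg) ?_ hexp
  filter_upwards [eventually_ge_atTop 1, (Metric.tendsto_nhds.1 hlim) (ε / 2) (by positivity)]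
    with n hn hn2
  obtain ⟨n, rfl⟩ : ∃ n', n = n' + 1 := ⟨n - 1, by omega⟩
  have hn' : (0 : ℝ) < (n + 1 : ℕ) := by positivity
  have h1 := hG.measureReal_abs_degreeCount_sub_ge_le k n (x := (n + 1 : ℕ) * (ε / 2))
    (by positivity)
  refine (measureReal_mono ?_).trans (h1.trans (le_of_eq ?_))
  · intro ω hω
    simp only [Set.mem_ofPred_eq, Real.norm_eq_abs, Real.dist_eq] at hω hn2 ⊢
    set E := ∫ ω', ((G ((n + 1) * (m + 1)) ω').degreeCount k : ℝ) ∂P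
    set Y := ((G ((n + 1) * (m + 1)) ω).degreeCount k : ℝ)
    have h3 : ε / 2 ≤ |Y / (n + 1 : ℕ) - E / (n + 1 : ℕ)| := by
      have := abs_sub_le (Y / (n + 1 : ℕ)) (E / (n + 1 : ℕ)) (limitLaw m k)
      linarith
    rw [← sub_div, abs_div, abs_of_pos hn', le_div_iff₀ hn'] at h3
    linarith
  · congr 2
    field_simp
    ring

theorem tendsto_measureReal_iSup_ge [IsProbabilityMeasure P] (hG : IsBAProcess P m G)
    (hm : 1 ≤ m) {V : ℕ → Ω → ℕ} (hV : IsUniformVertex P G V) {C : ℝ} (hC : (m : ℝ) * √8 < C) :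
    Tendsto (fun n : ℕ =>
      P.real {ω | C * √(((m : ℝ) + 1) * Real.log ((n : ℝ) * ((m : ℝ) + 1)) / (n : ℝ)) ≤
        ⨆ k : ℕ, |((G (n * (m + 1)) ω).degreeCount k : ℝ) / (n : ℝ) -
          P.real {ω' | (G (n * (m + 1)) ω').degree (V (n * (m + 1)) ω') = k}|})
      atTop (𝓝 0) := by
  have hm1 : (1 : ℝ) ≤ m := by exact_mod_cast hm
  have hC0 : 0 < C := lt_of_le_of_lt (by positivity) hC
  have hC2 : 8 * (m : ℝ) ^ 2 ≤ C ^ 2 := by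
    have h1 := pow_le_pow_left₀ (by positivity) hC.le 2
    rw [mul_pow, Real.sq_sqrt (by norm_num)] at h1
    linarith
  refine squeeze_zero' (Eventually.of_forall fun _ => measureReal_nonneg) ?_
    (tendsto_const_div_atTop_nhds_zero_nat 6)
  filter_upwards [eventually_ge_atTop 1] with n hn
  obtain ⟨n, rfl⟩ : ∃ n', n = n' + 1 := ⟨n - 1, by omega⟩
  have hn1 : (1 : ℝ) ≤ (n + 1 : ℕ) := by exact_mod_cast hn
  simp only [hG.measureReal_degree_uniformVertex hV]
  set E : ℕ → ℝ := fun k => ∫ ω', ((G ((n + 1) * (m + 1)) ω').degreeCount k : ℝ) ∂P with hE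
  set ν : ℝ := ((n + 1 : ℕ) : ℝ) with hν
  set L := Real.log (ν * (m + 1)) with hL
  have hνm : 1 < ν * (m + 1) := by nlinarith
  have hL0 : 0 < L := Real.log_pos hνm
  set ε := C * √((m + 1) * L / ν) with hε
  have hε0 : 0 < ε := by positivity
  set D := 2 * (m * (n + 1)) with hD
  -- The exponent is `ν ε² / (8 m) = C² (m + 1) L / (8 m) ≥ m (m + 1) L ≥ 2 L`, by `C² ≥ 8 m²` and
  -- `m ≥ 1`. Summed over the `2 m ν + 1` relevant degrees, the bound is at most `6 / ν`.
  have htail : ∀ k, P.real {ω | ε ≤ |((G ((n + 1) * (m + 1)) ω).degreeCount k : ℝ) / ν - E k / ν|}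
      ≤ 2 / (ν * (m + 1)) ^ 2 := by
    intro k
    have h1 := hG.measureReal_abs_degreeCount_sub_ge_le k n (x := ν * ε) (by positivity)
    refine (measureReal_mono ?_).trans (h1.trans ?_)
    · intro ω hω
      simp only [Set.mem_ofPred_eq] at hω ⊢
      rw [← sub_div, abs_div, abs_of_pos (by positivity : 0 < ν), le_div_iff₀ (by positivity)] at hω
      linarith
    · rw [div_eq_mul_inv (2 : ℝ)]
      refine mul_le_mul_of_nonneg_left ?_ (by norm_num)
      have h2 : ((ν * (m + 1)) ^ 2)⁻¹ = Real.exp (-(2 * L)) := by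
        rw [Real.exp_neg, two_mul, Real.exp_add, Real.exp_log (by positivity), sq]
      rw [h2, Real.exp_le_exp, neg_div, neg_le_neg_iff, le_div_iff₀ (by positivity), mul_pow, hε,
        mul_pow, Real.sq_sqrt (by positivity)]
      have h3 : ν ^ 2 * (C ^ 2 * ((m + 1) * L / ν)) = C ^ 2 * ((m + 1) * L * ν) := by
        field_simp
      rw [h3]
      calc 2 * L * (8 * (m * ν)) = 8 * m * 2 * (L * ν) := by ring
        _ ≤ 8 * m * (m * (m + 1)) * (L * ν) := by
            gcongr
            nlinarith
        _ = 8 * m ^ 2 * ((m + 1) * L * ν) := by ring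
        _ ≤ _ := by gcongr
  have hEzero : ∀ k, D < k → E k = 0 := by
    intro k hk
    simp only [hE]
    rw [integral_congr_ae (g := fun _ => (0 : ℝ)), integral_zero]
    filter_upwards [hG.ae_isBAState_mul n] with ω hω
    rw [hω.degreeCount_eq_zero hk, Nat.cast_zero]
  set U := ⋃ k ∈ Finset.range (D + 1),
    {ω | ε ≤ |((G ((n + 1) * (m + 1)) ω).degreeCount k : ℝ) / ν - E k / ν|} with hU
  have hsub : {ω | ε ≤ ⨆ k : ℕ, |((G ((n + 1) * (m + 1)) ω).degreeCount k : ℝ) / ν - E k / ν|}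
      ≤ᵐ[P] U := by
    filter_upwards [hG.ae_isBAState_mul n] with ω hω
    intro h
    by_contra hcon
    change ω ∉ U at hcon
    change ε ≤ _ at h
    simp only [hU, Set.mem_iUnion, Set.mem_ofPred_eq, not_exists, not_le] at hcon
    set f : ℕ → ℝ := fun k => |((G ((n + 1) * (m + 1)) ω).degreeCount k : ℝ) / ν - E k / ν|
    have hne : (Finset.range (D + 1)).Nonempty := ⟨0, by simp⟩
    -- Strict bounds on infinitely many terms would only give `≤ ε` for the supremum; the finite
    -- maximum keeps the inequality strict, and the terms beyond `D` vanish.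
    have hmax : (Finset.range (D + 1)).sup' hne f < ε := (Finset.sup'_lt_iff hne).2 hcon
    refine absurd h (not_le.2 (lt_of_le_of_lt (ciSup_le fun k => ?_) hmax))
    by_cases hk : k ≤ D
    · exact Finset.le_sup' f (Finset.mem_range.2 (by omega))
    · have h1 : f k = 0 := by
        simp only [f]
        rw [hω.degreeCount_eq_zero (by omega), hEzero k (by omega)]
        simp
      change f k ≤ _
      rw [h1]
      exact (abs_nonneg _).trans (Finset.le_sup' f (Finset.mem_range.2 (Nat.succ_pos D)))
  have h1 : P.real {ω | ε ≤ ⨆ k : ℕ, |((G ((n + 1) * (m + 1)) ω).degreeCount k : ℝ) / ν - E k / ν|}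
      ≤ P.real U := ENNReal.toReal_mono (measure_ne_top _ _) (measure_mono_ae hsub)
  refine h1.trans ((measureReal_biUnion_finset_le _ _).trans
    ((Finset.sum_le_sum fun k _ => htail k).trans ?_))
  rw [Finset.sum_const, Finset.card_range, nsmul_eq_mul, hD]
  push_cast
  have h2 : (n : ℝ) + 1 = ν := by rw [hν]; push_cast; ring
  rw [h2, mul_div_assoc', div_le_div_iff₀ (by positivity) (by positivity)]
  have h3 : 2 * (m * ν) + 1 ≤ 3 * (m * ν) := by nlinarith
  have h4 : (m : ℝ) ≤ (m + 1) ^ 2 := by nlinarith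
  calc (2 * (m * ν) + 1) * 2 * ν ≤ 3 * (m * ν) * 2 * ν := by gcongr
    _ = m * (6 * ν ^ 2) := by ring
    _ ≤ (m + 1) ^ 2 * (6 * ν ^ 2) := by gcongr
    _ = _ := by ring

end IsBAProcess

/-! ### The forward equation of a Yule process -/

/-- Probability that a Yule process of intensity `lam` grows from `i ≥ 1` to `j` individuals in a
time `h`. -/
noncomputable def yuleProb (lam : ℝ) (i j : ℕ) (h : ℝ) : ℝ :=
  if i ≤ j then ((j - 1).choose (i - 1) : ℝ) * Real.exp (-(lam * i * h)) *
    (1 - Real.exp (-(lam * h))) ^ (j - i) else 0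

theorem yuleProb_of_lt (lam : ℝ) {i j : ℕ} (hij : j < i) (h : ℝ) : yuleProb lam i j h = 0 :=
  if_neg (by omega)

theorem yuleProb_add (lam : ℝ) (a l : ℕ) (h : ℝ) :
    yuleProb lam (a + 1) (a + 1 + l) h = ((a + l).choose a : ℝ) *
      Real.exp (-(lam * (a + 1) * h)) * (1 - Real.exp (-(lam * h))) ^ l := by
  rw [yuleProb, if_pos (by omega), show a + 1 + l - 1 = a + l by omega,
    show a + 1 + l - (a + 1) = l by omega, Nat.add_sub_cancel]
  push_cast
  rfl

theorem yuleProb_zero (lam : ℝ) (i j : ℕ) : yuleProb lam i j 0 = if j = i then 1 else 0 := by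
  rcases lt_trichotomy j i with h | rfl | h
  · rw [yuleProb_of_lt lam h, if_neg h.ne]
  · simp [yuleProb]
  · rw [yuleProb, if_pos h.le, if_neg h.ne']
    simp [Nat.sub_ne_zero_of_lt h]

/-- The transition probabilities solve Kolmogorov's forward equation. -/
theorem hasDerivAt_yuleProb (lam : ℝ) {i : ℕ} (hi : 1 ≤ i) (j : ℕ) (h : ℝ) :
    HasDerivAt (yuleProb lam i j)
      (lam * (birthFlux (fun l => yuleProb lam i l h) j - j * yuleProb lam i j h)) h := by
  obtain ⟨a, rfl⟩ : ∃ a, i = a + 1 := ⟨i - 1, by omega⟩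
  rcases lt_or_ge j (a + 1) with hj | hj
  · have h0 : yuleProb lam (a + 1) j = fun _ => 0 := by
      funext x; exact yuleProb_of_lt lam hj x
    have h1 : birthFlux (fun l => yuleProb lam (a + 1) l h) j = 0 := by
      cases j with
      | zero => rfl
      | succ j => simp only [birthFlux]; rw [yuleProb_of_lt lam (by omega), mul_zero]
    rw [h0, h1]
    simpa using hasDerivAt_const h (0 : ℝ)
  · obtain ⟨l, rfl⟩ := Nat.exists_eq_add_of_le hj
    have hfun : yuleProb lam (a + 1) (a + 1 + l) = fun x => ((a + l).choose a : ℝ) *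
      Real.exp (-(lam * (a + 1) * x)) * (1 - Real.exp (-(lam * x))) ^ l := by
      funext x; exact yuleProb_add lam a l x
    have hE : ∀ c : ℝ, HasDerivAt (fun x => Real.exp (-(c * x))) (-c * Real.exp (-(c * h))) h := by
      intro c
      have h1 := (((hasDerivAt_id h).const_mul c).neg).exp
      refine h1.congr_deriv ?_
      simp only [Pi.neg_apply, id, mul_one]
      ring
    have hd := ((hE (lam * (a + 1))).const_mul ((a + l).choose a : ℝ)).mul
      (((hE lam).const_sub 1).pow l)
    have hd' := hd.congr_of_eventuallyEq (f₁ := yuleProb lam (a + 1) (a + 1 + l))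
      (Eventually.of_forall fun x => congrFun hfun x)
    refine hd'.congr_deriv ?_
    rw [yuleProb_add]
    cases l with
    | zero =>
      have h1 : birthFlux (fun l => yuleProb lam (a + 1) l h) (a + 1 + 0) = 0 := by
        simp only [birthFlux]
        rw [yuleProb_of_lt lam (by omega), mul_zero]
      rw [h1]
      simp
      ring
    | succ l =>
      have h1 : birthFlux (fun l => yuleProb lam (a + 1) l h) (a + 1 + (l + 1)) =
          ((a + 1 + l : ℕ) : ℝ) * yuleProb lam (a + 1) (a + 1 + l) h := rfl
      -- The factor `l + 1` from differentiating the power `(1 - y) ^ (l + 1)` is traded for the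
      -- birth rate `a + 1 + l` of the preceding state.
      have hchoose : ((l + 1 : ℕ) : ℝ) * ((a + (l + 1)).choose a : ℝ) =
          ((a + 1 + l : ℕ) : ℝ) * ((a + l).choose a : ℝ) := by
        have h2 := Nat.add_one_mul_choose_eq (a + l) l
        have h3 : (a + l).choose l = (a + l).choose a := by
          rw [Nat.choose_symm_add]
        have h4 : (a + (l + 1)).choose a = (a + l + 1).choose (l + 1) := by
          rw [show a + l + 1 = a + (l + 1) by ring, Nat.choose_symm_add]
        rw [h4, ← h3]
        have : (l + 1) * (a + l + 1).choose (l + 1) = (a + 1 + l) * (a + l).choose l := by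
          rw [show a + 1 + l = a + l + 1 by ring, h2, mul_comm]
        exact_mod_cast this
      rw [h1, yuleProb_add]
      simp only [Nat.add_sub_cancel, Pi.pow_apply]
      set E := Real.exp (-(lam * (a + 1) * h))
      set y := Real.exp (-(lam * h))
      push_cast at hchoose ⊢
      rw [pow_succ]
      linear_combination (lam * E * (1 - y) ^ l) * hchoose

theorem continuous_yuleProb (lam : ℝ) {i : ℕ} (hi : 1 ≤ i) (j : ℕ) :
    Continuous (yuleProb lam i j) :=
  continuous_iff_continuousAt.2 fun h => (hasDerivAt_yuleProb lam hi j h).continuousAt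

/-- Uniqueness for the forward equation of a linear birth process. -/
theorem forwardEquation_unique {lam : ℝ} {u v : ℕ → ℝ → ℝ}
    (huc : ∀ j, ContinuousOn (u j) (Set.Ici 0)) (hvc : ∀ j, ContinuousOn (v j) (Set.Ici 0))
    (hu : ∀ j, ∀ h, 0 ≤ h → HasDerivWithinAt (u j)
      (lam * (birthFlux (fun l => u l h) j - j * u j h)) (Set.Ici h) h)
    (hv : ∀ j, ∀ h, 0 ≤ h → HasDerivWithinAt (v j)
      (lam * (birthFlux (fun l => v l h) j - j * v j h)) (Set.Ici h) h)
    (h0 : ∀ j, u j 0 = v j 0) (j : ℕ) : ∀ h, 0 ≤ h → u j h = v j h := by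
  induction j using Nat.strong_induction_on with
  | _ j ih =>
  intro T hT
  have hflux : ∀ h, 0 ≤ h → birthFlux (fun l => u l h) j = birthFlux (fun l => v l h) j := by
    intro h hh
    cases j with
    | zero => rfl
    | succ j => simp only [birthFlux]; rw [ih j (by omega) h hh]
  have hE : ∀ h, HasDerivAt (fun x => Real.exp (lam * j * x))
      (lam * j * Real.exp (lam * j * h)) h := by
    intro h
    have h1 := ((hasDerivAt_id h).const_mul (lam * j)).exp
    refine h1.congr_deriv ?_
    simp only [id, mul_one]
    ring
  -- The system is triangular: once the flux from state `j - 1` agrees, the difference solves `w' =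
  -- -lam j w`, and the integrating factor makes it constant. Right derivatives and continuity
  -- suffice.
  have key := constant_of_has_deriv_right_zero
    (f := fun x => (u j x - v j x) * Real.exp (lam * j * x)) (a := 0) (b := T)
    ((((huc j).sub (hvc j)).mul (by fun_prop)).mono Set.Icc_subset_Ici_self) ?_ T ⟨hT, le_rfl⟩
  · simp only [h0 j, sub_self, zero_mul, mul_eq_zero, Real.exp_ne_zero, or_false] at key
    exact sub_eq_zero.1 key
  · intro x hx
    refine (((hu j x hx.1).sub (hv j x hx.1)).mul (hE x).hasDerivWithinAt).congr_deriv ?_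
    rw [hflux x hx.1]
    simp only [Pi.sub_apply]
    ring

/-! ### Yule processes -/

theorem measurableSet_pastSigma {Ω : Type*} (N : ℝ≥0 → Ω → ℕ) {s T : ℝ≥0} (hs : s ≤ T)
    (B : Set ℕ) : MeasurableSet[pastSigma N T] (N s ⁻¹' B) := by
  have h1 : MeasurableSpace.comap (N s) ⊤ ≤ pastSigma N T :=
    le_iSup (fun s : Set.Iic T => MeasurableSpace.comap (N s) ⊤) ⟨s, hs⟩
  exact h1 _ ⟨B, trivial, rfl⟩

theorem pastSigma_mono {Ω : Type*} (N : ℝ≥0 → Ω → ℕ) {s T : ℝ≥0} (hs : s ≤ T) :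
    pastSigma N s ≤ pastSigma N T :=
  iSup_le fun r => le_iSup (fun s : Set.Iic T => MeasurableSpace.comap (N s) ⊤)
    ⟨r, (show (r : ℝ≥0) ≤ s from r.2).trans hs⟩

/-- The rates of a linear birth process. -/
def birthRate (lam : ℝ) (k j : ℕ) : ℝ :=
  if j = k then -(k * lam) else if j = k + 1 then k * lam else 0

theorem sum_mul_birthRate (lam : ℝ) (f : ℕ → ℝ) (j : ℕ) :
    ∑ k ∈ Finset.range (j + 1), f k * birthRate lam k j = lam * (birthFlux f j - j * f j) := by
  have h0 : ∀ j, birthRate lam j j = -(j * lam) := fun j => if_pos rfl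
  cases j with
  | zero => simp [birthRate, birthFlux]
  | succ j =>
    rw [Finset.sum_range_succ, Finset.sum_range_succ, Finset.sum_eq_zero, h0, birthRate,
      if_neg (by omega), if_pos rfl]
    · simp only [birthFlux]; push_cast; ring
    · intro k hk
      rw [Finset.mem_range] at hk
      rw [birthRate, if_neg (by omega), if_neg (by omega), mul_zero]

/-- The three infinitesimal conditions in the form identity plus `h` times generator plus `o(h)`,
for the entries `k ≤ j` that nondecreasing paths can use. -/
theorem IsYuleTransition.isLittleO {lam : ℝ} {p : ℝ≥0 → ℕ → ℕ → ℝ} (hp : IsYuleTransition lam p)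
    {k j : ℕ} (hkj : k ≤ j) :
    (fun h : ℝ≥0 => p h k j - (if j = k then 1 else 0) - h * birthRate lam k j)
      =o[𝓝[>] 0] (fun h : ℝ≥0 => (h : ℝ)) := by
  obtain ⟨l, rfl⟩ := Nat.exists_eq_add_of_le hkj
  rcases l with _ | _ | l
  · refine (hp.no_birth k).congr_left fun h => ?_
    simp [birthRate]
    ring
  · refine (hp.one_birth k).congr_left fun h => ?_
    simp [birthRate]
    ring
  · refine (hp.many_births k (l + 2) (by omega)).congr_left fun h => ?_
    simp [birthRate]

theorem IsYuleTransition.tendsto {lam : ℝ} {p : ℝ≥0 → ℕ → ℕ → ℝ} (hp : IsYuleTransition lam p)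
    {k j : ℕ} (hkj : k ≤ j) :
    Tendsto (fun h : ℝ≥0 => p h k j - if j = k then 1 else 0) (𝓝[>] 0) (𝓝 0) := by
  have h0 : Tendsto (fun h : ℝ≥0 => (h : ℝ)) (𝓝[>] 0) (𝓝 0) :=
    (NNReal.continuous_coe.tendsto' 0 0 rfl).mono_left nhdsWithin_le_nhds
  have h1 := ((hp.isLittleO hkj).trans_tendsto h0).add (h0.mul_const (birthRate lam k j))
  simpa using h1

theorem tendsto_toNNReal_sub {x : ℝ} :
    Tendsto (fun y : ℝ => (y - x).toNNReal) (𝓝[>] x) (𝓝[>] 0) := by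
  refine tendsto_nhdsWithin_iff.2 ⟨?_, ?_⟩
  · have h1 : Continuous fun y : ℝ => (y - x).toNNReal := by fun_prop
    exact (h1.tendsto' x 0 (by simp)).mono_left nhdsWithin_le_nhds
  · filter_upwards [self_mem_nhdsWithin] with y hy
    have : x < y := hy
    simpa using this

namespace IsYuleProcess

variable {Ω : Type*} [MeasurableSpace Ω] {Q : Measure Ω} {lam : ℝ} {a : ℕ} {N : ℝ≥0 → Ω → ℕ}

theorem measurableSet_eq (hN : IsYuleProcess Q lam a N) (T : ℝ≥0) (j : ℕ) :
    MeasurableSet {ω | N T ω = j} := hN.measurable T (MeasurableSet.of_discrete (s := {j}))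

theorem pastSigma_le (hN : IsYuleProcess Q lam a N) (T : ℝ≥0) :
    pastSigma N T ≤ ‹MeasurableSpace Ω› :=
  iSup_le fun s => (hN.measurable s).comap_le

/-- The probabilities of passing from a past event to the present states evolve according to
Kolmogorov's forward equation. -/
theorem measureReal_inter_eq [IsProbabilityMeasure Q] (hN : IsYuleProcess Q lam a N) {s : ℝ≥0}
    {A : Set Ω} (hA : MeasurableSet[pastSigma N s] A) {i : ℕ} (hi : 1 ≤ i)
    (hAi : ∀ᵐ ω ∂Q, ω ∈ A → N s ω = i) (h : ℝ≥0) (j : ℕ) :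
    Q.real (A ∩ {ω | N (s + h) ω = j}) = Q.real A * yuleProb lam i j h := by
  obtain ⟨p, hp, hmarkov⟩ := hN.markov
  have hA' : MeasurableSet A := hN.pastSigma_le s _ hA
  set U : ℕ → ℝ≥0 → ℝ := fun j h => Q.real (A ∩ {ω | N (s + h) ω = j}) with hU
  have hU01 : ∀ j h, U j h ∈ Set.Icc (0 : ℝ) 1 := fun j h =>
    ⟨measureReal_nonneg, measureReal_le_one⟩
  -- Monotone paths restrict the intermediate state to `k ≤ j`; the sum is finite and small-`δ`
  -- estimates may be taken term by term.
  have hstep : ∀ j (h δ : ℝ≥0), U j (h + δ) = ∑ k ∈ Finset.range (j + 1), U k h * p δ k j := by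
    intro j h δ
    have hsum := hasSum_measureReal_inter_fiber Q (hN.measurableSet_eq (s + h))
      (hA'.inter (hN.measurableSet_eq (s + (h + δ)) j))
    have hterm : ∀ k, Q.real (A ∩ {ω | N (s + (h + δ)) ω = j} ∩ {ω | N (s + h) ω = k}) =
        U k h * p δ k j := by
      intro k
      rw [Set.inter_right_comm, ← add_assoc]
      exact hmarkov (s + h) δ A (pastSigma_mono N le_self_add _ hA) k j
    rw [hU]
    refine (hsum.unique (hasSum_sum_of_ne_finset_zero (s := Finset.range (j + 1)) ?_)).trans
      (Finset.sum_congr rfl fun k _ => hterm k)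
    intro k hk
    rw [Finset.mem_range] at hk
    convert measureReal_empty (μ := Q) using 2
    ext ω
    simp only [Set.mem_inter_iff, Set.mem_ofPred_eq, Set.mem_empty_iff_false, iff_false]
    rintro ⟨⟨_, h1⟩, h2⟩
    have := hN.monotone ω (show s + h ≤ s + (h + δ) by rw [← add_assoc]; exact le_self_add)
    simp only [h1, h2] at this
    omega
  have hself : ∀ j (c : ℕ → ℝ),
      ∑ k ∈ Finset.range (j + 1), c k * (if j = k then (1 : ℝ) else 0) = c j := by
    intro j c
    simp
  set u : ℕ → ℝ → ℝ := fun j x => U j x.toNNReal with hu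
  have hadd : ∀ {x y : ℝ}, 0 ≤ x → x ≤ y → y.toNNReal = x.toNNReal + (y - x).toNNReal := by
    intro x y hx hxy
    rw [← Real.toNNReal_add hx (sub_nonneg.2 hxy)]
    congr 1; ring
  have hmain := forwardEquation_unique (lam := lam) (u := u)
    (v := fun j x => Q.real A * yuleProb lam i j x) ?_ ?_ ?_ ?_ ?_ j h h.2
  · simpa only [hu, hU, Real.toNNReal_coe] using hmain
  · intro j
    -- This modulus does not depend on the starting time, so it gives continuity from the left as
    -- well as from the right.
    have hmod : Tendsto (fun δ : ℝ≥0 => ∑ k ∈ Finset.range (j + 1),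
        |p δ k j - if j = k then 1 else 0|) (𝓝[>] 0) (𝓝 0) := by
      have h1 : Tendsto (fun δ : ℝ≥0 => ∑ k ∈ Finset.range (j + 1),
        |p δ k j - if j = k then 1 else 0|) (𝓝[>] 0) (𝓝 (∑ _k ∈ Finset.range (j + 1), |(0 : ℝ)|)) :=
        tendsto_finsetSum _ fun k hk => (hp.tendsto (by rw [Finset.mem_range] at hk; omega)).abs
      simpa using h1
    have hdiff : ∀ x δ, |U j (x + δ) - U j x| ≤ ∑ k ∈ Finset.range (j + 1),
        |p δ k j - if j = k then 1 else 0| := by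
      intro x δ
      have h1 : U j (x + δ) - U j x = ∑ k ∈ Finset.range (j + 1),
          U k x * (p δ k j - if j = k then 1 else 0) := by
        rw [hstep]
        simp only [mul_sub, Finset.sum_sub_distrib]
        rw [hself j fun k => U k x]
      rw [h1]
      refine (Finset.abs_sum_le_sum_abs _ _).trans (Finset.sum_le_sum fun k _ => ?_)
      rw [abs_mul, abs_of_nonneg (hU01 k x).1]
      exact mul_le_of_le_one_left (abs_nonneg _) (hU01 k x).2
    rw [Metric.continuousOn_iff]
    intro x hx ε hε
    have hev := hmod.eventually (gt_mem_nhds hε)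
    obtain ⟨η, hη, hηs⟩ := (mem_nhdsGT_iff_exists_Ioo_subset (a := (0 : ℝ≥0))).1 hev
    have hηs' : ∀ z y : ℝ, 0 ≤ z → z < y → y - z < η → |u j y - u j z| < ε := by
      intro z y hz hzy hy
      simp only [hu]
      rw [hadd hz hzy.le]
      refine (hdiff _ _).trans_lt (hηs ⟨?_, ?_⟩)
      · simpa using hzy
      · exact (Real.toNNReal_lt_iff_lt_coe (by linarith)).2 hy
    refine ⟨η, hη, fun y hy hyx => ?_⟩
    rw [Real.dist_eq] at hyx ⊢
    have hyx' := abs_lt.1 hyx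
    rcases lt_trichotomy x y with hxy | rfl | hxy
    · exact hηs' x y hx hxy hyx'.2
    · simpa using hε
    · rw [abs_sub_comm]
      exact hηs' y x hy hxy (by linarith [hyx'.1])
  · exact fun j => ((continuous_yuleProb lam hi j).const_mul _).continuousOn
  · intro j x hx
    rw [← hasDerivWithinAt_Ioi_iff_Ici, hasDerivWithinAt_iff_isLittleO]
    have h1 : (fun δ : ℝ≥0 => ∑ k ∈ Finset.range (j + 1), U k x.toNNReal *
        (p δ k j - (if j = k then 1 else 0) - δ * birthRate lam k j)) =o[𝓝[>] 0]
        (fun δ : ℝ≥0 => (δ : ℝ)) :=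
      IsLittleO.fun_sum fun k hk => (hp.isLittleO
        (by rw [Finset.mem_range] at hk; omega)).const_mul_left _
    refine (h1.comp_tendsto tendsto_toNNReal_sub).congr' ?_ ?_
    · filter_upwards [self_mem_nhdsWithin] with y hy
      have hxy : x ≤ y := le_of_lt hy
      simp only [hu, Function.comp]
      rw [hadd hx hxy, hstep, ← sum_mul_birthRate, smul_eq_mul,
        Real.coe_toNNReal _ (sub_nonneg.2 hxy)]
      simp only [mul_sub, Finset.sum_sub_distrib]
      rw [hself j fun k => U k x.toNNReal]
      simp only [Finset.mul_sum]
      congr 1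
      refine Finset.sum_congr rfl fun k _ => ?_
      ring
    · filter_upwards [self_mem_nhdsWithin] with y hy
      have hxy : x ≤ y := le_of_lt hy
      exact Real.coe_toNNReal _ (sub_nonneg.2 hxy)
  · intro j x _
    refine (((hasDerivAt_yuleProb lam hi j x).const_mul (Q.real A)).hasDerivWithinAt).congr_deriv ?_
    cases j with
    | zero => simp [birthFlux]
    | succ j => simp only [birthFlux]; ring
  · intro j
    simp only [hu, hU, Real.toNNReal_zero, add_zero]
    rw [yuleProb_zero]
    split_ifs with hji
    · rw [mul_one]
      refine measureReal_congr ?_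
      filter_upwards [hAi] with ω hω
      refine propext ⟨fun hx => hx.1, fun hx => ⟨hx, ?_⟩⟩
      exact (hω hx).trans hji.symm
    · rw [mul_zero, measureReal_eq_zero_iff, measure_eq_zero_iff_ae_notMem]
      filter_upwards [hAi] with ω hω hx
      exact hji (hx.2.symm.trans (hω hx.1))

theorem measureReal_eq [IsProbabilityMeasure Q] (hN : IsYuleProcess Q lam a N) (ha : 1 ≤ a)
    (T : ℝ≥0) (j : ℕ) : Q.real {ω | N T ω = j} = yuleProb lam a j T := by
  have h1 := hN.measureReal_inter_eq (s := 0) (A := Set.univ) MeasurableSet.univ ha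
    (hN.initial.mono fun ω hω _ => hω) T j
  simpa using h1

theorem measureReal_eq_and_eq [IsProbabilityMeasure Q] (hN : IsYuleProcess Q lam a N)
    (ha : 1 ≤ a) (s h : ℝ≥0) {i : ℕ} (hi : 1 ≤ i) (j : ℕ) :
    Q.real ({ω | N s ω = i} ∩ {ω | N (s + h) ω = j}) =
      yuleProb lam a i s * yuleProb lam i j h := by
  rw [← hN.measureReal_eq ha]
  exact hN.measureReal_inter_eq (measurableSet_pastSigma N le_rfl {i}) hi
    (ae_of_all _ fun ω hω => hω) h j

end IsYuleProcess

/-! ### Birth times of the genera -/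

section BirthTime

variable {Ω : Type*} {N : ℝ≥0 → Ω → ℕ}

/-- A right-continuous integer-valued path is constant just after `s`, so the infimum is attained.
The hypothesis `hT` excludes the empty set, whose infimum would be 0. -/
theorem genusBirthTime_le_iff {ω : Ω} (hmono : Monotone fun T => N T ω)
    (hrc : ∀ T, ContinuousWithinAt (fun s => N s ω) (Set.Ici T) T) {j : ℕ} {T : ℝ≥0}
    (hT : j + 1 ≤ N T ω) (s : ℝ≥0) : genusBirthTime N j ω ≤ s ↔ j + 1 ≤ N s ω := by
  refine ⟨fun h => ?_, fun h => csInf_le (OrderBot.bddBelow _) h⟩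
  by_contra hlt
  have hev : ∀ᶠ x in 𝓝[≥] s, N x ω = N s ω :=
    (hrc s).eventually (p := fun y => y = N s ω)
      (by simp [nhds_discrete])
  obtain ⟨η, hη, hsub⟩ := (mem_nhdsGE_iff_exists_Ico_subset' (lt_add_one s)).1 hev
  have h1 : η ≤ genusBirthTime N j ω := by
    refine le_csInf ⟨T, hT⟩ fun x hx => ?_
    by_contra hxη
    rcases le_total s x with hsx | hsx
    · have h2 : N x ω = N s ω := hsub ⟨hsx, not_le.1 hxη⟩
      have h3 : j + 1 ≤ N x ω := hx
      omega
    · exact hlt (le_trans hx (hmono hsx))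
  exact absurd (h1.trans h) (not_le.2 hη)

theorem genusBirthTime_of_forall_le {ω : Ω} {j : ℕ} (h : ∀ T, N T ω ≤ j) :
    genusBirthTime N j ω = 0 := by
  have h1 : {T : ℝ≥0 | j + 1 ≤ N T ω} = ∅ := by
    ext T
    simp only [Set.mem_ofPred_eq, Set.mem_empty_iff_false, iff_false]
    have := h T
    omega
  rw [genusBirthTime, h1, NNReal.sInf_empty]

theorem measurable_genusBirthTime [MeasurableSpace Ω] (hN : ∀ T, Measurable (N T))
    (hmono : ∀ ω, Monotone fun T => N T ω)
    (hrc : ∀ ω T, ContinuousWithinAt (fun s => N s ω) (Set.Ici T) T) (j : ℕ) :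
    Measurable (genusBirthTime N j) := by
  refine measurable_of_Iic fun s => ?_
  -- The second set collects the paths on which genus `j` never appears, where the birth time has
  -- the default value `0 ≤ s`.
  have hset : genusBirthTime N j ⁻¹' Set.Iic s =
      {ω | j + 1 ≤ N s ω} ∪ ⋂ n : ℕ, {ω | N n ω ≤ j} := by
    ext ω
    simp only [Set.mem_preimage, Set.mem_Iic, Set.mem_union, Set.mem_ofPred_eq, Set.mem_iInter]
    by_cases h : ∃ T, j + 1 ≤ N T ω
    · obtain ⟨T, hT⟩ := h
      rw [genusBirthTime_le_iff (hmono ω) (hrc ω) hT, or_iff_left]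
      intro hall
      obtain ⟨n, hn⟩ := exists_nat_ge T
      have h1 : N T ω ≤ N n ω := hmono ω hn
      have h2 := hall n
      omega
    · push Not at h
      rw [genusBirthTime_of_forall_le fun T => Nat.lt_succ_iff.1 (h T)]
      exact iff_of_true zero_le (Or.inr fun n => Nat.lt_succ_iff.1 (h n))
  rw [hset]
  exact (hN s (MeasurableSet.of_discrete (s := {x | j + 1 ≤ x}))).union
    (MeasurableSet.iInter fun n => hN n (MeasurableSet.of_discrete (s := {x | x ≤ j})))

theorem measurable_tsub_genusBirthTime [MeasurableSpace Ω] (hN : ∀ T, Measurable (N T))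
    (hmono : ∀ ω, Monotone fun T => N T ω)
    (hrc : ∀ ω T, ContinuousWithinAt (fun s => N s ω) (Set.Ici T) T) (T : ℝ≥0) (j : ℕ) :
    Measurable fun ω => T - genusBirthTime N j ω :=
  measurable_const.sub (measurable_genusBirthTime hN hmono hrc j)

end BirthTime

/-! ### A uniformly chosen genus -/

/-- Unnormalised mean of one plus a binomial variable, by `(a + 1) C(R + 1, a + 1) = (R + 1) C(R,
a)`. -/
theorem sum_choose_mul_succ (R : ℕ) (u v : ℝ) :
    ∑ a ∈ Finset.range (R + 1), ((a : ℝ) + 1) * ((R.choose a : ℝ) * u ^ a * v ^ (R - a)) =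
      (u + v) ^ R + R * u * (u + v) ^ (R - 1) := by
  have h1 : ∑ a ∈ Finset.range (R + 1), (R.choose a : ℝ) * u ^ a * v ^ (R - a) = (u + v) ^ R := by
    rw [add_pow]
    exact Finset.sum_congr rfl fun a _ => by ring
  have h2 : ∑ a ∈ Finset.range (R + 1), (a : ℝ) * ((R.choose a : ℝ) * u ^ a * v ^ (R - a)) =
      R * u * (u + v) ^ (R - 1) := by
    cases R with
    | zero => simp
    | succ R =>
      rw [Finset.sum_range_succ', Nat.add_sub_cancel, add_pow, Finset.mul_sum]
      simp only [Nat.cast_zero, zero_mul, add_zero]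
      refine Finset.sum_congr rfl fun a _ => ?_
      have h3 : ((a + 1 : ℕ) : ℝ) * ((R + 1).choose (a + 1) : ℝ) =
          ((R + 1 : ℕ) : ℝ) * (R.choose a : ℝ) := by
        have := Nat.add_one_mul_choose_eq R a
        rw [mul_comm ((R + 1).choose (a + 1))] at this
        exact_mod_cast this.symm
      rw [show R + 1 - (a + 1) = R - a by omega, pow_succ]
      linear_combination (u ^ a * u * v ^ (R - a)) * h3
  rw [← h1, ← h2, ← Finset.sum_add_distrib]
  exact Finset.sum_congr rfl fun a _ => by ring

/-- The mean number of genera at time `s` on the event that there are `r` genera at time `s + x`. -/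
theorem sum_mul_yuleProb_mul (s x : ℝ) (R : ℕ) :
    (∑ i ∈ Finset.range (R + 1 + 1), (i : ℝ) * (yuleProb 1 1 i s * yuleProb 1 i (R + 1) x)) *
        (1 - Real.exp (-(s + x))) =
      yuleProb 1 1 (R + 1) (s + x) *
        (1 - Real.exp (-(s + x)) + R * (Real.exp (-x) - Real.exp (-(s + x)))) := by
  set q := Real.exp (-s)
  set p := Real.exp (-x)
  have hqp : Real.exp (-(s + x)) = q * p := by rw [neg_add, Real.exp_add]
  have h1 : ∀ a (y : ℝ), yuleProb 1 1 (a + 1) y = Real.exp (-y) * (1 - Real.exp (-y)) ^ a := by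
    intro a y
    have := yuleProb_add 1 0 a y
    simpa [add_comm] using this
  rw [Finset.sum_range_succ']
  simp only [Nat.cast_zero, zero_mul, add_zero]
  -- Given `R + 1` genera at time `s + x`, the number at time `s` minus one is binomial, with
  -- weights proportional to `(1 - q) p` and `1 - p`.
  have h2 : ∀ a ∈ Finset.range (R + 1), ((a + 1 : ℕ) : ℝ) *
      (yuleProb 1 1 (a + 1) s * yuleProb 1 (a + 1) (R + 1) x) =
      q * p * (((a : ℝ) + 1) * ((R.choose a : ℝ) * ((1 - q) * p) ^ a * (1 - p) ^ (R - a))) := by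
    intro a ha
    rw [Finset.mem_range] at ha
    have h3 := yuleProb_add 1 a (R - a) x
    rw [show a + 1 + (R - a) = R + 1 by omega, show a + (R - a) = R by omega] at h3
    rw [h1, h3]
    have h4 : Real.exp (-(1 * ((a : ℝ) + 1) * x)) = p * p ^ a := by
      rw [← Real.exp_nat_mul, ← Real.exp_add]
      congr 1; ring
    rw [h4, one_mul, mul_pow]
    push_cast
    ring
  rw [Finset.sum_congr rfl h2, ← Finset.mul_sum, sum_choose_mul_succ, h1, hqp,
    show (1 - q) * p + (1 - p) = 1 - q * p by ring]
  cases R with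
  | zero => simp
  | succ R =>
    rw [Nat.add_sub_cancel, pow_succ]
    ring

theorem measurable_genera_yuleModelSigma {Ω : Type*} (N : ℝ≥0 → Ω → ℕ) (X : ℕ → ℝ≥0 → Ω → ℕ) (T : ℝ≥0) :
    Measurable[yuleModelSigma N X] (N T) := by
  rw [measurable_iff_comap_le]
  exact le_sup_of_le_left (le_iSup (fun T => MeasurableSpace.comap (N T) ⊤) T)

theorem measurable_species_yuleModelSigma {Ω : Type*} (N : ℝ≥0 → Ω → ℕ) (X : ℕ → ℝ≥0 → Ω → ℕ) (j : ℕ)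
    (T : ℝ≥0) : Measurable[yuleModelSigma N X] (X j T) := by
  rw [measurable_iff_comap_le]
  exact le_sup_of_le_right
    (le_iSup₂ (f := fun (j : ℕ) (T : ℝ≥0) => MeasurableSpace.comap (X j T) ⊤) j T)

theorem measurable_choice {Ω β : Type*} [MeasurableSpace Ω] [MeasurableSpace β] {J : Ω → ℕ} (hJ : Measurable J)
    {F : ℕ → Ω → β} (hF : ∀ j, Measurable (F j)) : Measurable fun ω => F (J ω) ω := by
  have h1 : Measurable fun x : ℕ × Ω => F x.1 x.2 := measurable_from_prod_countable_right hF
  exact h1.comp (hJ.prodMk measurable_id)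

namespace IsYuleModel

variable {Ω : Type*} [MeasurableSpace Ω] {Q : Measure Ω} {m : ℕ} {lam : ℝ}
  {N : ℝ≥0 → Ω → ℕ} {X : ℕ → ℝ≥0 → Ω → ℕ}

theorem yuleModelSigma_le {β : ℝ} (hY : IsYuleModel Q m lam β N X) :
    yuleModelSigma N X ≤ ‹MeasurableSpace Ω› :=
  sup_le (iSup_le fun T => (hY.genera.measurable T).comap_le)
    (iSup_le fun j => iSup_le fun T => ((hY.species j).measurable T).comap_le)

theorem ae_one_le (hY : IsYuleModel Q m lam 1 N X) : ∀ᵐ ω ∂Q, ∀ T, 1 ≤ N T ω := by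
  filter_upwards [hY.genera.initial] with ω hω T
  have h1 : N 0 ω ≤ N T ω := hY.genera.monotone ω zero_le
  omega

/-- The probability of an event about a uniformly chosen genus. -/
theorem hasSum_uniformGenus [IsProbabilityMeasure Q] (hY : IsYuleModel Q m lam 1 N X)
    {J : ℝ≥0 → Ω → ℕ} (hJ : IsUniformGenus Q N X J) (T : ℝ≥0) {A : ℕ → Set Ω}
    (hA : ∀ j, MeasurableSet[yuleModelSigma N X] (A j)) :
    HasSum (fun r : ℕ => (∑ j ∈ Finset.range r, Q.real (A j ∩ {ω | N T ω = r})) / r)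
      (Q.real {ω | ω ∈ A (J T ω)}) := by
  have hA' : ∀ j, MeasurableSet (A j) := fun j => hY.yuleModelSigma_le _ (hA j)
  have hJm : ∀ j, MeasurableSet {ω | J T ω = j} := fun j =>
    hJ.measurable T (MeasurableSet.of_discrete (s := {j}))
  have hNm := hY.genera.measurableSet_eq T
  have hE : MeasurableSet {ω | ω ∈ A (J T ω)} := by
    have h1 : {ω | ω ∈ A (J T ω)} = ⋃ j, A j ∩ {ω | J T ω = j} := by
      ext ω
      simp
    rw [h1]
    exact MeasurableSet.iUnion fun j => (hA' j).inter (hJm j)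
  -- The `r` prescribed masses exhaust `N T = r`, so larger labels carry no mass; for `r = 0` the
  -- event itself is null.
  have hzero : ∀ r j, r ≤ j → Q.real ({ω | N T ω = r} ∩ {ω | J T ω = j}) = 0 := by
    intro r j hrj
    rcases Nat.eq_zero_or_pos r with rfl | hr
    · rw [measureReal_eq_zero_iff, measure_eq_zero_iff_ae_notMem]
      filter_upwards [hY.ae_one_le] with ω h1 h2
      have h3 := h1 T
      have h4 : N T ω = 0 := h2.1
      omega
    · have hsum := hasSum_measureReal_inter_fiber Q hJm (hNm r)
      have h1 := sum_le_hasSum (insert j (Finset.range r)) (fun _ _ => measureReal_nonneg) hsum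
      have hu : ∀ i ∈ Finset.range r, Q.real ({ω | N T ω = r} ∩ {ω | J T ω = i}) =
          Q.real {ω | N T ω = r} / r := by
        intro i hi
        have := hJ.uniform T Set.univ MeasurableSet.univ r i (Finset.mem_range.1 hi)
        simpa only [Set.univ_inter] using this
      rw [Finset.sum_insert (by simpa using hrj), Finset.sum_congr rfl hu, Finset.sum_const,
        Finset.card_range, nsmul_eq_mul, mul_div_cancel₀ _ (by positivity)] at h1
      exact le_antisymm (by linarith) measureReal_nonneg
  convert hasSum_measureReal_inter_fiber Q hNm hE using 2 with r
  have hsum := hasSum_measureReal_inter_fiber Q hJm (hE.inter (hNm r))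
  have hset : ∀ j, {ω | ω ∈ A (J T ω)} ∩ {ω | N T ω = r} ∩ {ω | J T ω = j} =
      A j ∩ {ω | N T ω = r} ∩ {ω | J T ω = j} := by
    intro j
    ext ω
    simp only [Set.mem_inter_iff, Set.mem_ofPred_eq]
    constructor
    · rintro ⟨⟨h1, h2⟩, rfl⟩; exact ⟨⟨h1, h2⟩, rfl⟩
    · rintro ⟨⟨h1, h2⟩, rfl⟩; exact ⟨⟨h1, h2⟩, rfl⟩
  simp only [hset] at hsum
  rw [hsum.unique (hasSum_sum_of_ne_finset_zero (s := Finset.range r) ?_), Finset.sum_div]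
  · exact Finset.sum_congr rfl fun j hj =>
      (hJ.uniform T (A j) (hA j) r j (Finset.mem_range.1 hj)).symm
  · intro j hj
    rw [Finset.mem_range, not_lt] at hj
    refine le_antisymm ((measureReal_mono ?_).trans (hzero r j hj).le) measureReal_nonneg
    exact fun ω h => ⟨h.1.2, h.2⟩

/-- The age at time `T` of the chosen genus. -/
noncomputable def genusAge (N : ℝ≥0 → Ω → ℕ) (J : ℝ≥0 → Ω → ℕ) (T : ℝ≥0) (ω : Ω) : ℝ≥0 :=
  T - genusBirthTime N (J T ω) ω

theorem measurable_sub_genusBirthTime (hY : IsYuleModel Q m lam 1 N X) (T : ℝ≥0) (j : ℕ) :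
    Measurable[yuleModelSigma N X] fun ω => T - genusBirthTime N j ω := by
  exact @measurable_tsub_genusBirthTime Ω N (yuleModelSigma N X)
    (measurable_genera_yuleModelSigma N X) hY.genera.monotone hY.genera.rightContinuous T j

theorem measurable_genusAge (hY : IsYuleModel Q m lam 1 N X)
    {J : ℝ≥0 → Ω → ℕ} (hJ : IsUniformGenus Q N X J) (T : ℝ≥0) : Measurable (genusAge N J T) :=
  measurable_choice (hJ.measurable T) fun j =>
    (hY.measurable_sub_genusBirthTime T j).mono hY.yuleModelSigma_le le_rfl

/-- A genus `j` present at time `T` has age at least `x` exactly when `j < N (T - x)`, so the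
probability is `E[N (T - x) / N T]`, expanded over the values `r` of `N T`. -/
theorem hasSum_le_genusAge [IsProbabilityMeasure Q] (hY : IsYuleModel Q m lam 1 N X)
    {J : ℝ≥0 → Ω → ℕ} (hJ : IsUniformGenus Q N X J) {T x : ℝ≥0} (hxT : x ≤ T) :
    HasSum (fun r : ℕ => (∑ i ∈ Finset.range (r + 1),
      (i : ℝ) * (yuleProb 1 1 i (T - x : ℝ≥0) * yuleProb 1 i r x)) / r)
      (Q.real {ω | x ≤ genusAge N J T ω}) := by
  have h := hY.hasSum_uniformGenus hJ T (A := fun j => {ω | x ≤ T - genusBirthTime N j ω})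
    fun j => hY.measurable_sub_genusBirthTime T j measurableSet_Ici
  refine h.congr_fun fun r => ?_
  congr 1
  have hpair : ∀ i ∈ Finset.range (r + 1),
      (i : ℝ) * (yuleProb 1 1 i (T - x : ℝ≥0) * yuleProb 1 i r x) =
        i * Q.real ({ω | N (T - x) ω = i} ∩ {ω | N T ω = r}) := by
    intro i _
    rcases Nat.eq_zero_or_pos i with rfl | hi
    · simp
    · have := hY.genera.measureReal_eq_and_eq le_rfl (T - x) x hi r
      rw [tsub_add_cancel_of_le hxT] at this
      rw [this]
  rw [Finset.sum_congr rfl hpair]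
  have hone : ∀ j ∈ Finset.range r,
      Q.real ({ω | x ≤ T - genusBirthTime N j ω} ∩ {ω | N T ω = r}) =
      ∑ i ∈ Finset.range (r + 1),
        if j < i then Q.real ({ω | N (T - x) ω = i} ∩ {ω | N T ω = r}) else 0 := by
    intro j hj
    rw [Finset.mem_range] at hj
    have hset : {ω | x ≤ T - genusBirthTime N j ω} ∩ {ω | N T ω = r} =
        {ω | j < N (T - x) ω} ∩ {ω | N T ω = r} := by
      ext ω
      simp only [Set.mem_inter_iff, Set.mem_ofPred_eq]
      refine and_congr_left fun hr => ?_
      have hjT : j + 1 ≤ N T ω := by omega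
      have hiff := genusBirthTime_le_iff (hY.genera.monotone ω) (hY.genera.rightContinuous ω) hjT
      rw [le_tsub_iff_right ((hiff T).2 hjT), ← le_tsub_iff_left hxT, hiff]
      rfl
    have hm1 : MeasurableSet {ω | j < N (T - x) ω} :=
      hY.genera.measurable _ (MeasurableSet.of_discrete (s := {y | j < y}))
    have hsum := hasSum_measureReal_inter_fiber Q (hY.genera.measurableSet_eq (T - x))
      (hm1.inter (hY.genera.measurableSet_eq T r))
    rw [hset, hsum.unique (hasSum_sum_of_ne_finset_zero (s := Finset.range (r + 1)) ?_)]
    · refine Finset.sum_congr rfl fun i _ => ?_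
      split_ifs with hji
      · congr 1
        ext ω
        simp only [Set.mem_inter_iff, Set.mem_ofPred_eq]
        constructor
        · rintro ⟨⟨_, h2⟩, h3⟩; exact ⟨h3, h2⟩
        · rintro ⟨h3, h2⟩; exact ⟨⟨by omega, h2⟩, h3⟩
      · convert measureReal_empty (μ := Q) using 2
        ext ω
        simp only [Set.mem_inter_iff, Set.mem_ofPred_eq, Set.mem_empty_iff_false, iff_false]
        rintro ⟨⟨h1, _⟩, h3⟩
        omega
    · intro i hi
      rw [Finset.mem_range] at hi
      convert measureReal_empty (μ := Q) using 2
      ext ω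
      simp only [Set.mem_inter_iff, Set.mem_ofPred_eq, Set.mem_empty_iff_false, iff_false]
      rintro ⟨⟨_, h2⟩, h3⟩
      have h4 : N (T - x) ω ≤ N T ω := hY.genera.monotone ω tsub_le_self
      omega
  rw [Finset.sum_congr rfl hone, Finset.sum_comm]
  refine Finset.sum_congr rfl fun i hi => ?_
  rw [Finset.mem_range] at hi
  rw [← Finset.sum_filter, Finset.sum_const, nsmul_eq_mul]
  congr 2
  have : Finset.filter (fun j => j < i) (Finset.range r) = Finset.range i := by
    ext j
    simp only [Finset.mem_filter, Finset.mem_range]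
    omega
  rw [this, Finset.card_range]

theorem hasSum_yuleProb_genera [IsProbabilityMeasure Q] (hY : IsYuleModel Q m lam 1 N X)
    (T : ℝ≥0) : HasSum (fun r => yuleProb 1 1 r T) 1 := by
  have h := hasSum_measureReal_inter_fiber Q (hY.genera.measurableSet_eq T) MeasurableSet.univ
  simp only [Set.univ_inter, hY.genera.measureReal_eq le_rfl, probReal_univ] at h
  exact h

/-- The age of a uniformly chosen genus is asymptotically exponential. -/
theorem tendsto_measureReal_le_genusAge [IsProbabilityMeasure Q] (hY : IsYuleModel Q m lam 1 N X)
    {J : ℝ≥0 → Ω → ℕ} (hJ : IsUniformGenus Q N X J) (x : ℝ≥0) :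
    Tendsto (fun T : ℝ≥0 => Q.real {ω | x ≤ genusAge N J T ω}) atTop (𝓝 (Real.exp (-x))) := by
  -- Success probability of the binomial law of `N (T - x) - 1` given `N T`.
  set c : ℝ≥0 → ℝ := fun T => (Real.exp (-x) - Real.exp (-(T : ℝ))) / (1 - Real.exp (-(T : ℝ)))
    with hc
  have hcoe : Tendsto (fun T : ℝ≥0 => (T : ℝ)) atTop atTop := NNReal.tendsto_coe_atTop.2 tendsto_id
  have hexp : Tendsto (fun T : ℝ≥0 => Real.exp (-(T : ℝ))) atTop (𝓝 0) :=
    Real.tendsto_exp_neg_atTop_nhds_zero.comp hcoe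
  have hclim : Tendsto c atTop (𝓝 (Real.exp (-x))) := by
    have := (hexp.const_sub (Real.exp (-x))).div (hexp.const_sub 1) (by norm_num)
    rw [sub_zero, sub_zero, div_one] at this
    exact this
  have hhalf : Tendsto (fun T : ℝ≥0 => c T + 3 * Real.exp (-((T : ℝ) / 2))) atTop
      (𝓝 (Real.exp (-x))) := by
    have h1 : Tendsto (fun T : ℝ≥0 => Real.exp (-((T : ℝ) / 2))) atTop (𝓝 0) :=
      Real.tendsto_exp_neg_atTop_nhds_zero.comp (hcoe.atTop_div_const (by norm_num))
    simpa using hclim.add (h1.const_mul 3)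
  have hev : ∀ᶠ T : ℝ≥0 in atTop, c T ≤ Q.real {ω | x ≤ genusAge N J T ω} ∧
      Q.real {ω | x ≤ genusAge N J T ω} ≤ c T + 3 * Real.exp (-((T : ℝ) / 2)) := by
    filter_upwards [eventually_ge_atTop x, eventually_gt_atTop 0] with T hxT hT0
    have hT0' : (0 : ℝ) < T := by exact_mod_cast hT0
    have hxT' : (x : ℝ) ≤ T := by exact_mod_cast hxT
    have hsum := hY.hasSum_le_genusAge hJ hxT
    have htot := hY.hasSum_yuleProb_genera T
    set e := Real.exp (-(T : ℝ)) with he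
    have he0 : 0 < e := Real.exp_pos _
    have he1 : e < 1 := by rw [he, Real.exp_lt_one_iff]; linarith
    have hex : e ≤ Real.exp (-x) := Real.exp_le_exp.2 (by linarith)
    have hc0 : 0 ≤ c T := div_nonneg (by linarith) (by linarith)
    have hc1 : c T ≤ 1 := by
      refine (div_le_one (by linarith)).2 ?_
      have : Real.exp (-(x : ℝ)) ≤ 1 := Real.exp_le_one_iff.2 (by simp)
      linarith
    have hy : ∀ r, yuleProb 1 1 (r + 1) T = e * (1 - e) ^ r := by
      intro r
      have := yuleProb_add 1 0 r (T : ℝ)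
      simpa [add_comm, he] using this
    have hy0 : ∀ r, 0 ≤ yuleProb 1 1 r T := by
      rintro (_ | r)
      · rw [yuleProb_of_lt _ (by omega)]
      · rw [hy]
        exact mul_nonneg he0.le (pow_nonneg (by linarith) _)
    have hye : ∀ r, yuleProb 1 1 r T ≤ e := by
      rintro (_ | r)
      · rw [yuleProb_of_lt _ (by omega)]; exact he0.le
      · rw [hy]
        exact mul_le_of_le_one_right he0.le (pow_le_one₀ (by linarith) (by linarith))
    -- The conditional mean of `N (T - x)` is `1 + (r - 1) c`, and `(1 + (r - 1) c) / r = c + (1 -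
    -- c) / r`. It remains to see that the mean of `1 / N T` vanishes.
    have hterm : ∀ r : ℕ, (∑ i ∈ Finset.range (r + 1),
        (i : ℝ) * (yuleProb 1 1 i (T - x : ℝ≥0) * yuleProb 1 i r x)) / r =
        yuleProb 1 1 r T * (c T + (1 - c T) / r) := by
      rintro (_ | r)
      · rw [yuleProb_of_lt _ (show 0 < 1 by omega)]; simp
      · have h1 := sum_mul_yuleProb_mul (T - x : ℝ≥0) x r
        have h2 : ((T - x : ℝ≥0) : ℝ) + x = T := by
          rw [NNReal.coe_sub hxT]; ring
        rw [h2, ← he] at h1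
        have h3 : 1 - e ≠ 0 := by linarith
        rw [← eq_div_iff h3] at h1
        have hcT : c T = (Real.exp (-x) - e) / (1 - e) := rfl
        rw [h1, hcT]
        push_cast
        field_simp
        ring
    simp only [hterm] at hsum
    constructor
    · have h1 := htot.mul_right (c T)
      rw [one_mul] at h1
      refine hasSum_le (fun r => mul_le_mul_of_nonneg_left ?_ (hy0 r)) h1 hsum
      have : 0 ≤ (1 - c T) / (r : ℝ) := div_nonneg (by linarith) (by positivity)
      linarith
    -- Split at `K ≈ exp (T / 2)`: below `K` each value of `N T` has mass at most `exp (-T)`, in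
    -- total at most `2 w`; from `K` on, `1 / r ≤ w`. This gives the constant 3.
    · set K := ⌈Real.exp ((T : ℝ) / 2)⌉₊ with hK
      have hKl : Real.exp ((T : ℝ) / 2) ≤ K := Nat.le_ceil _
      have hKu : (K : ℝ) < Real.exp ((T : ℝ) / 2) + 1 := Nat.ceil_lt_add_one (Real.exp_pos _).le
      set w := Real.exp (-((T : ℝ) / 2)) with hw
      have hw0 : 0 < w := Real.exp_pos _
      have hw1 : w ≤ 1 := Real.exp_le_one_iff.2 (by linarith)
      have hwe : e = w * w := by rw [he, hw, ← Real.exp_add]; ring_nf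
      have hwi : Real.exp ((T : ℝ) / 2) * w = 1 := by rw [hw, ← Real.exp_add]; simp
      have hK0 : (0 : ℝ) < K := (Real.exp_pos _).trans_le hKl
      have hKinv : 1 / (K : ℝ) ≤ w := by
        rw [div_le_iff₀ hK0, ← hwi]
        nlinarith
      have hfin : HasSum (fun r => if r ∈ Finset.range K then e else 0) (K * e) := by
        have : HasSum (fun r => if r ∈ Finset.range K then e else 0)
            (∑ r ∈ Finset.range K, if r ∈ Finset.range K then e else 0) :=
          hasSum_sum_of_ne_finset_zero fun r hr => if_neg hr
        convert this using 1
        rw [Finset.sum_congr rfl fun r hr => if_pos hr]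
        simp
      have h1 := (htot.mul_right (c T + w)).add hfin
      refine (hasSum_le (fun r => ?_) hsum h1).trans ?_
      · by_cases hr : r ∈ Finset.range K
        · rw [if_pos hr]
          have h2 : (1 - c T) / r ≤ 1 := by
            rcases Nat.eq_zero_or_pos r with rfl | hr0
            · simp
            · have : (1 : ℝ) ≤ r := by exact_mod_cast hr0
              exact div_le_one_of_le₀ (by linarith) (by positivity)
          nlinarith [hy0 r, hye r, mul_nonneg (hy0 r) hw0.le, mul_nonneg (hy0 r) (sub_nonneg.2 h2)]
        · rw [if_neg hr, add_zero]
          refine mul_le_mul_of_nonneg_left ?_ (hy0 r)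
          rw [Finset.mem_range, not_lt] at hr
          have h2 : (1 - c T) / r ≤ 1 / K := by
            refine div_le_div₀ zero_le_one (by linarith) hK0 (by exact_mod_cast hr)
          linarith
      · nlinarith
  exact tendsto_of_tendsto_of_tendsto_of_le_of_le' hclim hhalf (hev.mono fun _ h => h.1)
    (hev.mono fun _ h => h.2)

end IsYuleModel

/-! ### Evaluating a process at an independent random time -/

theorem hasSum_setIntegral_fiber {Ω ι : Type*} [MeasurableSpace Ω] [Countable ι] {Q : Measure Ω}
    {X : Ω → ι} (hX : ∀ x, MeasurableSet {ω | X ω = x}) {g : Ω → ℝ} (hg : Integrable g Q) :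
    HasSum (fun x => ∫ ω in {ω | X ω = x}, g ω ∂Q) (∫ ω, g ω ∂Q) := by
  have huniv : (⋃ x, {ω | X ω = x}) = Set.univ := by ext ω; simp
  have h := hasSum_integral_iUnion (μ := Q) (f := g) hX (fun x y hxy =>
    Set.disjoint_left.2 fun ω h1 h2 => hxy (h1.symm.trans h2)) hg.integrableOn
  rwa [huniv, setIntegral_univ] at h

/-- The point of the grid `ℕ / (n + 1)` following `s`. -/
noncomputable def gridAbove (n : ℕ) (s : ℝ≥0) : ℝ≥0 := (⌊s * (n + 1)⌋₊ + 1) / (n + 1)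

theorem lt_gridAbove (n : ℕ) (s : ℝ≥0) : s < gridAbove n s := by
  rw [gridAbove, lt_div_iff₀ (by positivity)]
  exact Nat.lt_floor_add_one _

theorem gridAbove_le (n : ℕ) (s : ℝ≥0) : gridAbove n s ≤ s + 1 / (n + 1) := by
  rw [gridAbove, add_div]
  gcongr
  rw [div_le_iff₀ (by positivity)]
  exact Nat.floor_le zero_le

theorem tendsto_gridAbove (s : ℝ≥0) : Tendsto (fun n => gridAbove n s) atTop (𝓝[≥] s) := by
  refine tendsto_nhdsWithin_iff.2 ⟨?_, Eventually.of_forall fun n => (lt_gridAbove n s).le⟩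
  have h1 : Tendsto (fun n : ℕ => s + 1 / ((n : ℝ≥0) + 1)) atTop (𝓝 (s + 0)) :=
    tendsto_one_div_add_atTop_nhds_zero_nat.const_add s
  rw [add_zero] at h1
  exact tendsto_of_tendsto_of_tendsto_of_le_of_le tendsto_const_nhds h1
    (fun n => (lt_gridAbove n s).le) fun n => gridAbove_le n s

/-- For a time on a grid the claim is a countable sum over grid points. Approximating `S` by grid
points from above, right-continuity of the paths and continuity of `f` carry it to the limit. -/
theorem measureReal_evaluate_eq_integral {Ω : Type*} [MeasurableSpace Ω] {Q : Measure Ω}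
    [IsProbabilityMeasure Q] {S : Ω → ℝ≥0} (hS : Measurable S) {Y : ℝ≥0 → Ω → ℕ}
    (hY : ∀ s, Measurable (Y s))
    (hrc : ∀ ω s, ContinuousWithinAt (fun s => Y s ω) (Set.Ici s) s) {f : ℝ≥0 → ℝ}
    (hf : Continuous f) (hf1 : ∀ s, |f s| ≤ 1) {k : ℕ}
    (h : ∀ (s : ℝ≥0) (B : Set ℝ≥0), MeasurableSet B →
      Q.real (S ⁻¹' B ∩ {ω | Y s ω = k}) = Q.real (S ⁻¹' B) * f s) :
    Q.real {ω | Y (S ω) ω = k} = ∫ ω, f (S ω) ∂Q := by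
  set I : ℕ → Ω → ℕ := fun n ω => ⌊S ω * (n + 1)⌋₊ with hI
  have hIm : ∀ n, Measurable (I n) := fun n => Nat.measurable_floor.comp (hS.mul_const _)
  have hIset : ∀ n i, MeasurableSet {ω | I n ω = i} := fun n i =>
    hIm n (MeasurableSet.of_discrete (s := {i}))
  have hgrid : ∀ n i ω, I n ω = i → gridAbove n (S ω) = (i + 1) / (n + 1) := by
    rintro n i ω rfl
    rfl
  have hYn : ∀ n, Measurable fun ω => Y (gridAbove n (S ω)) ω := fun n =>
    measurable_choice (hIm n) (F := fun i ω => Y ((i + 1) / (n + 1)) ω) fun i => hY _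
  have hlimY : ∀ ω, Tendsto (fun n => Y (gridAbove n (S ω)) ω) atTop (𝓝 (Y (S ω) ω)) := fun ω =>
    (hrc ω (S ω)).tendsto.comp (tendsto_gridAbove (S ω))
  have hYS : Measurable fun ω => Y (S ω) ω :=
    measurable_of_tendsto_metrizable hYn (tendsto_pi_nhds.2 hlimY)
  have hfib : ∀ {Z : Ω → ℕ}, Measurable Z → MeasurableSet {ω | Z ω = k} := fun hZ =>
    hZ (MeasurableSet.of_discrete (s := {k}))
  have hgm : ∀ n, Measurable fun ω => gridAbove n (S ω) := fun n =>
    measurable_choice (hIm n) (F := fun i _ => ((i : ℝ≥0) + 1) / (n + 1)) fun i => measurable_const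
  have hfint : ∀ n, Integrable (fun ω => f (gridAbove n (S ω))) Q := fun n =>
    Integrable.of_bound ((hf.measurable.comp (hgm n)).aestronglyMeasurable) 1
      (ae_of_all _ fun ω => hf1 _)
  have hn : ∀ n, Q.real {ω | Y (gridAbove n (S ω)) ω = k} = ∫ ω, f (gridAbove n (S ω)) ∂Q := by
    intro n
    refine (hasSum_measureReal_inter_fiber Q (hIset n) (hfib (hYn n))).unique
      ((hasSum_setIntegral_fiber (hIset n) (hfint n)).congr_fun fun i => ?_)
    have h1 : {ω | Y (gridAbove n (S ω)) ω = k} ∩ {ω | I n ω = i} =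
        {ω | I n ω = i} ∩ {ω | Y ((i + 1) / (n + 1)) ω = k} := by
      ext ω
      simp only [Set.mem_inter_iff, Set.mem_ofPred_eq]
      constructor
      · rintro ⟨h1, h2⟩; rw [hgrid n i ω h2] at h1; exact ⟨h2, h1⟩
      · rintro ⟨h2, h1⟩; rw [hgrid n i ω h2]; exact ⟨h1, h2⟩
    have hB : MeasurableSet {s : ℝ≥0 | ⌊s * (n + 1)⌋₊ = i} :=
      (Nat.measurable_floor.comp (measurable_id.mul_const _))
        (MeasurableSet.of_discrete (s := {i}))
    rw [h1, setIntegral_congr_fun (hIset n i) (g := fun _ => f ((i + 1) / (n + 1)))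
      fun ω hω => congrArg f (hgrid n i ω hω), setIntegral_const, smul_eq_mul]
    exact h _ _ hB
  have hone : ∀ {Z : Ω → ℕ}, Measurable Z →
      Q.real {ω | Z ω = k} = ∫ ω, (if Z ω = k then (1 : ℝ) else 0) ∂Q := by
    intro Z hZ
    rw [← integral_indicator_one (hfib hZ)]
    refine integral_congr_ae (ae_of_all _ fun ω => ?_)
    simp [Set.indicator_apply]
  have hlim1 : Tendsto (fun n => Q.real {ω | Y (gridAbove n (S ω)) ω = k}) atTop
      (𝓝 (Q.real {ω | Y (S ω) ω = k})) := by
    rw [hone hYS]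
    simp only [hone (hYn _)]
    refine tendsto_integral_of_dominated_convergence (fun _ => 1) (fun n => ?_)
      (integrable_const _) (fun n => ae_of_all _ fun ω => ?_) (ae_of_all _ fun ω => ?_)
    · exact (Measurable.ite (hfib (hYn n)) measurable_const measurable_const).aestronglyMeasurable
    · split_ifs <;> simp
    · refine tendsto_const_nhds.congr' ?_
      have := (hlimY ω).eventually (p := fun y => y = Y (S ω) ω) (by simp [nhds_discrete])
      filter_upwards [this] with n hn
      rw [hn]
  have hlim2 : Tendsto (fun n => ∫ ω, f (gridAbove n (S ω)) ∂Q) atTop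
      (𝓝 (∫ ω, f (S ω) ∂Q)) := by
    refine tendsto_integral_of_dominated_convergence (fun _ => 1)
      (fun n => (hfint n).aestronglyMeasurable) (integrable_const _)
      (fun n => ae_of_all _ fun ω => hf1 _) (ae_of_all _ fun ω => ?_)
    exact (hf.tendsto _).comp ((tendsto_gridAbove _).mono_right nhdsWithin_le_nhds)
  simp only [hn] at hlim1
  exact tendsto_nhds_unique hlim1 hlim2

theorem measurable_eval_comap {Ω : Type*} (N : ℝ≥0 → Ω → ℕ) (T : ℝ≥0) :
    Measurable[MeasurableSpace.comap (fun (ω : Ω) (T : ℝ≥0) => N T ω) inferInstance] (N T) := by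
  have h1 : Measurable fun F : ℝ≥0 → ℕ => F T := measurable_pi_apply T
  exact h1.comp (comap_measurable fun (ω : Ω) (T : ℝ≥0) => N T ω)

namespace IsYuleModel

variable {Ω : Type*} [MeasurableSpace Ω] {Q : Measure Ω} {m : ℕ} {lam : ℝ}
  {N : ℝ≥0 → Ω → ℕ} {X : ℕ → ℝ≥0 → Ω → ℕ}

/-- Birth times and `N T` are functions of the genera process, which is independent of the species
processes. -/
theorem measureReal_genera_inter_species [IsProbabilityMeasure Q]
    (hY : IsYuleModel Q m lam 1 N X) (hm : 1 ≤ m) (T s : ℝ≥0) (j k r : ℕ) {B : Set ℝ≥0}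
    (hB : MeasurableSet B) :
    Q.real ((fun ω => T - genusBirthTime N j ω) ⁻¹' B ∩ {ω | X j s ω = k} ∩ {ω | N T ω = r}) =
      Q.real ((fun ω => T - genusBirthTime N j ω) ⁻¹' B ∩ {ω | N T ω = r}) *
        yuleProb lam m k s := by
  have hmono := hY.genera.monotone
  have hrc := hY.genera.rightContinuous
  have hage := @measurable_tsub_genusBirthTime Ω N
    (MeasurableSpace.comap (fun (ω : Ω) (T : ℝ≥0) => N T ω) inferInstance)
    (measurable_eval_comap N) hmono hrc T j
  have hset1 : MeasurableSet[MeasurableSpace.comap (fun (ω : Ω) (T : ℝ≥0) => N T ω) inferInstance]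
      ((fun ω => T - genusBirthTime N j ω) ⁻¹' B ∩ {ω | N T ω = r}) := (hage hB).inter
    (measurable_eval_comap N T (MeasurableSet.of_discrete (s := {r})))
  have heval : Measurable fun F : ℕ → ℝ≥0 → ℕ => F j s :=
    (measurable_pi_apply s).comp (measurable_pi_apply j)
  have hset2 : MeasurableSet[MeasurableSpace.comap
      (fun (ω : Ω) (j : ℕ) (T : ℝ≥0) => X j T ω) inferInstance] {ω | X j s ω = k} :=
    ⟨{F : ℕ → ℝ≥0 → ℕ | F j s = k},
      heval (MeasurableSet.of_discrete (s := {k})), rfl⟩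
  have hind := (Indep_iff _ _ _).1 hY.indep_genera _ _ hset1 hset2
  rw [Set.inter_right_comm, ← (hY.species j).measureReal_eq hm s k]
  simp only [measureReal_def]
  rw [hind, ENNReal.toReal_mul]

/-- The size of a uniformly chosen genus is distributed as a Yule process evaluated at the age of
the genus. -/
theorem measureReal_genusSize_eq_integral [IsProbabilityMeasure Q]
    (hY : IsYuleModel Q m lam 1 N X) (hm : 1 ≤ m) {J : ℝ≥0 → Ω → ℕ}
    (hJ : IsUniformGenus Q N X J) (T : ℝ≥0) (k : ℕ) :
    Q.real {ω | genusSize N X T (J T ω) ω = k} =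
      ∫ ω, yuleProb lam m k (genusAge N J T ω) ∂Q := by
  have hf1 : ∀ s : ℝ≥0, |yuleProb lam m k s| ≤ 1 := by
    intro s
    rw [← (hY.species 0).measureReal_eq hm s k, abs_of_nonneg measureReal_nonneg]
    exact measureReal_le_one
  refine measureReal_evaluate_eq_integral (hY.measurable_genusAge hJ T)
    (Y := fun s ω => X (J T ω) s ω) (f := fun s => yuleProb lam m k s)
    (fun s => measurable_choice (hJ.measurable T) fun j => (hY.species j).measurable s)
    (fun ω s => (hY.species (J T ω)).rightContinuous ω s)
    ((continuous_yuleProb lam hm k).comp NNReal.continuous_coe) hf1 ?_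
  -- The label `J T` is itself random. Expanding over `N T` and the uniform label reduces the
  -- factorisation to a fixed genus, where the species law does not depend on the label.
  intro s B hB
  have h1 := hY.hasSum_uniformGenus hJ T (A := fun j => (fun ω => T - genusBirthTime N j ω) ⁻¹' B)
    fun j => hY.measurable_sub_genusBirthTime T j hB
  have h2 := hY.hasSum_uniformGenus hJ T
    (A := fun j => (fun ω => T - genusBirthTime N j ω) ⁻¹' B ∩ {ω | X j s ω = k})
    fun j => (hY.measurable_sub_genusBirthTime T j hB).inter
      (measurable_species_yuleModelSigma N X j s (MeasurableSet.of_discrete (s := {k})))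
  refine h2.unique ((h1.mul_right (yuleProb lam m k s)).congr_fun fun r => ?_)
  simp only [hY.measureReal_genera_inter_species hm T s _ k r hB]
  rw [← Finset.sum_mul]
  ring

/-- Limits of expectations of smooth functions of the age of a uniformly chosen genus. -/
theorem tendsto_integral_genusAge [IsProbabilityMeasure Q] (hY : IsYuleModel Q m lam 1 N X)
    {J : ℝ≥0 → Ω → ℕ} (hJ : IsUniformGenus Q N X J) {f f' : ℝ → ℝ}
    (hf : ∀ x, HasDerivAt f (f' x) x) (hf' : Continuous f')
    (hint : IntegrableOn f' (Set.Ioi 0)) :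
    Tendsto (fun T : ℝ≥0 => ∫ ω, f (genusAge N J T ω) ∂Q) atTop
      (𝓝 (f 0 + ∫ x in Set.Ioi 0, f' x * Real.exp (-x))) := by
  have hAm := hY.measurable_genusAge hJ
  -- Tail formula from `f A = f 0 + ∫ x in 0..A, f' x` and Fubini. It expresses the expectation
  -- through the tails of the age, whose limits are known; `|f'|` dominates.
  have hrepr : ∀ T : ℝ≥0, ∫ ω, f (genusAge N J T ω) ∂Q =
      f 0 + ∫ x in Set.Ioi (0 : ℝ), f' x * Q.real {ω | x.toNNReal ≤ genusAge N J T ω} := by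
    intro T
    set A := genusAge N J T with hA
    have hset : MeasurableSet {z : Ω × ℝ | z.2 ≤ A z.1} :=
      measurableSet_le measurable_snd ((hAm T).coe_nnreal_real.comp measurable_fst)
    set F : Ω → ℝ → ℝ := fun ω x => if x ≤ A ω then f' x else 0 with hF
    have hFint : Integrable (Function.uncurry F) (Q.prod (volume.restrict (Set.Ioi 0))) := by
      have h1 : Integrable (fun z : Ω × ℝ => f' z.2) (Q.prod (volume.restrict (Set.Ioi 0))) :=
        Integrable.comp_snd hint Q
      refine (h1.indicator hset).congr (ae_of_all _ fun z => ?_)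
      simp [Set.indicator_apply, Function.uncurry, hF]
    have hpt : ∀ ω, f (A ω) = f 0 + ∫ x in Set.Ioi (0 : ℝ), F ω x := by
      intro ω
      have h1 := intervalIntegral.integral_eq_sub_of_hasDerivAt (a := 0) (b := A ω)
        (fun x _ => hf x) (hf'.intervalIntegrable _ _)
      rw [intervalIntegral.integral_of_le (A ω).coe_nonneg] at h1
      have h2 : ∫ x in Set.Ioi (0 : ℝ), F ω x = ∫ x in Set.Ioc 0 (A ω : ℝ), f' x := by
        have h3 : F ω = (Set.Iic (A ω : ℝ)).indicator f' := by
          funext x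
          simp [hF, Set.indicator_apply]
        rw [h3, setIntegral_indicator measurableSet_Iic]
        rfl
      rw [h2, h1]
      ring
    have hFint' : Integrable (fun ω => ∫ x in Set.Ioi (0 : ℝ), F ω x) Q := hFint.integral_prod_left
    simp only [hpt]
    rw [integral_add (integrable_const _) hFint', integral_const,
      integral_integral_swap hFint]
    simp only [probReal_univ, one_smul]
    congr 1
    refine setIntegral_congr_fun measurableSet_Ioi fun x hx => ?_
    have hms : MeasurableSet {ω | x.toNNReal ≤ A ω} := measurableSet_le measurable_const (hAm T)
    have h4 : (fun ω => F ω x) = {ω | x.toNNReal ≤ A ω}.indicator fun _ => f' x := by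
      funext ω
      simp [hF, Set.indicator_apply, Real.toNNReal_le_iff_le_coe]
    simp only [h4]
    rw [integral_indicator hms, setIntegral_const, smul_eq_mul, mul_comm]
  simp only [hrepr]
  refine Tendsto.const_add _ ?_
  refine tendsto_integral_filter_of_dominated_convergence (fun x => ‖f' x‖)
    (Eventually.of_forall fun T => ?_) (Eventually.of_forall fun T => ae_of_all _ fun x => ?_)
    hint.norm ?_
  · have hanti : Antitone fun x : ℝ => Q.real {ω | x.toNNReal ≤ genusAge N J T ω} :=
      fun x y hxy => measureReal_mono fun ω hω => (Real.toNNReal_le_toNNReal hxy).trans hω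
    exact hf'.aestronglyMeasurable.mul hanti.measurable.aestronglyMeasurable
  · rw [norm_mul]
    refine mul_le_of_le_one_right (norm_nonneg _) ?_
    rw [Real.norm_of_nonneg measureReal_nonneg]
    exact measureReal_le_one
  · filter_upwards [ae_restrict_mem measurableSet_Ioi] with x hx
    have h1 := (hY.tendsto_measureReal_le_genusAge hJ x.toNNReal).const_mul (f' x)
    rwa [Real.coe_toNNReal x (le_of_lt hx)] at h1

end IsYuleModel

/-! ### Exponential mixtures of the Yule laws. -/

theorem integrableOn_yuleProb {lam : ℝ} (hlam : 0 < lam) {i : ℕ} (hi : 1 ≤ i) (j : ℕ) :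
    IntegrableOn (yuleProb lam i j) (Set.Ioi 0) := by
  rcases lt_or_ge j i with hj | hj
  · have h0 : yuleProb lam i j = fun _ => 0 := by
      funext x; exact yuleProb_of_lt lam hj x
    rw [h0]
    exact integrableOn_zero
  · have hpos : 0 < lam * i := by
      have : (0 : ℝ) < i := by exact_mod_cast hi
      positivity
    have h1 : IntegrableOn (fun x => ((j - 1).choose (i - 1) : ℝ) * Real.exp (-(lam * i) * x))
        (Set.Ioi 0) := (exp_neg_integrableOn_Ioi 0 hpos).const_mul _
    refine Integrable.mono' h1 (continuous_yuleProb lam hi j).aestronglyMeasurable ?_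
    filter_upwards [ae_restrict_mem measurableSet_Ioi] with x hx
    have hx0 : 0 < x := hx
    have hy0 : Real.exp (-(lam * x)) ≤ 1 := Real.exp_le_one_iff.2 (by nlinarith)
    have hy1 := Real.exp_pos (-(lam * x))
    rw [yuleProb, if_pos hj, Real.norm_of_nonneg (mul_nonneg (by positivity)
      (pow_nonneg (by linarith) _)), neg_mul]
    exact mul_le_of_le_one_right (by positivity) (pow_le_one₀ (by linarith) (by linarith))

theorem integrableOn_birthFlux_yuleProb {lam : ℝ} (hlam : 0 < lam) {i : ℕ} (hi : 1 ≤ i) (j : ℕ) :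
    IntegrableOn (fun x => birthFlux (fun l => yuleProb lam i l x) j) (Set.Ioi 0) := by
  cases j with
  | zero => exact integrableOn_zero
  | succ j => exact (integrableOn_yuleProb hlam hi j).const_mul _

theorem continuous_birthFlux_yuleProb (lam : ℝ) {i : ℕ} (hi : 1 ≤ i) (j : ℕ) :
    Continuous fun x => birthFlux (fun l => yuleProb lam i l x) j := by
  cases j with
  | zero => exact continuous_const
  | succ j => exact (continuous_yuleProb lam hi j).const_mul _

theorem integrableOn_mul_exp_neg {f : ℝ → ℝ} (hf : Continuous f)
    (hint : IntegrableOn f (Set.Ioi 0)) :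
    IntegrableOn (fun x => f x * Real.exp (-x)) (Set.Ioi 0) := by
  refine Integrable.mono' hint.norm (by fun_prop) ?_
  filter_upwards [ae_restrict_mem measurableSet_Ioi] with x hx
  have hx0 : 0 < x := hx
  rw [norm_mul]
  refine mul_le_of_le_one_right (norm_nonneg _) ?_
  rw [Real.norm_of_nonneg (Real.exp_pos _).le]
  exact Real.exp_le_one_iff.2 (by linarith)

theorem tendsto_yuleProb_mul_exp_neg {lam : ℝ} (hlam : 0 < lam) (i j : ℕ) :
    Tendsto (fun x => yuleProb lam i j x * Real.exp (-x)) atTop (𝓝 0) := by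
  have h1 : Tendsto (fun x => ((j - 1).choose (i - 1) : ℝ) * Real.exp (-x)) atTop (𝓝 0) := by
    simpa using Real.tendsto_exp_neg_atTop_nhds_zero.const_mul ((j - 1).choose (i - 1) : ℝ)
  refine squeeze_zero_norm' ?_ h1
  filter_upwards [eventually_ge_atTop 0] with x hx
  rw [norm_mul, Real.norm_of_nonneg (Real.exp_pos (-x)).le]
  refine mul_le_mul_of_nonneg_right ?_ (Real.exp_pos _).le
  have hy0 : Real.exp (-(lam * x)) ≤ 1 := Real.exp_le_one_iff.2 (by nlinarith)
  have hy1 := Real.exp_pos (-(lam * x))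
  have hz : Real.exp (-(lam * i * x)) ≤ 1 := Real.exp_le_one_iff.2 (by
    have : 0 ≤ lam * i * x := by positivity
    linarith)
  unfold yuleProb
  split_ifs
  · rw [Real.norm_of_nonneg (mul_nonneg (by positivity) (pow_nonneg (by linarith) _))]
    refine (mul_le_of_le_one_right (by positivity)
      (pow_le_one₀ (by linarith) (by linarith))).trans ?_
    exact mul_le_of_le_one_right (by positivity) hz
  · simp

/-- The derivative of `yuleProb` in time, given by the forward equation. -/
noncomputable def yuleProbDeriv (lam : ℝ) (i j : ℕ) (x : ℝ) : ℝ :=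
  lam * (birthFlux (fun l => yuleProb lam i l x) j - j * yuleProb lam i j x)

theorem continuous_yuleProbDeriv (lam : ℝ) {i : ℕ} (hi : 1 ≤ i) (j : ℕ) :
    Continuous (yuleProbDeriv lam i j) :=
  ((continuous_birthFlux_yuleProb lam hi j).sub
    ((continuous_yuleProb lam hi j).const_mul _)).const_mul _

theorem integrableOn_yuleProbDeriv {lam : ℝ} (hlam : 0 < lam) {i : ℕ} (hi : 1 ≤ i) (j : ℕ) :
    IntegrableOn (yuleProbDeriv lam i j) (Set.Ioi 0) :=
  ((integrableOn_birthFlux_yuleProb hlam hi j).sub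
    ((integrableOn_yuleProb hlam hi j).const_mul _)).const_mul _

/-- Integration by parts against the exponential law. -/
theorem yuleProb_zero_add_integral {lam : ℝ} (hlam : 0 < lam) {i : ℕ} (hi : 1 ≤ i) (j : ℕ) :
    yuleProb lam i j 0 + ∫ x in Set.Ioi 0, yuleProbDeriv lam i j x * Real.exp (-x) =
      ∫ x in Set.Ioi 0, yuleProb lam i j x * Real.exp (-x) := by
  have hi1 := integrableOn_mul_exp_neg (continuous_yuleProbDeriv lam hi j)
    (integrableOn_yuleProbDeriv hlam hi j)
  have hi2 := integrableOn_mul_exp_neg (continuous_yuleProb lam hi j)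
    (integrableOn_yuleProb hlam hi j)
  have hE : ∀ x, HasDerivAt (fun x => Real.exp (-x)) (-Real.exp (-x)) x := by
    intro x
    simpa using (hasDerivAt_id x).neg.exp
  have h1 := integral_Ioi_of_hasDerivAt_of_tendsto (a := 0)
    (f := fun x => yuleProb lam i j x * Real.exp (-x))
    (f' := fun x => yuleProbDeriv lam i j x * Real.exp (-x) - yuleProb lam i j x * Real.exp (-x))
    ((continuous_yuleProb lam hi j).mul (by fun_prop)).continuousWithinAt
    (fun x _ => ((hasDerivAt_yuleProb lam hi j x).mul (hE x)).congr_deriv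
      (by rw [yuleProbDeriv]; ring))
    (hi1.sub hi2) (tendsto_yuleProb_mul_exp_neg hlam i j)
  rw [integral_sub hi1 hi2] at h1
  simp only [neg_zero, Real.exp_zero, mul_one] at h1
  linarith

/-- The exponential mixture of the laws of the Yule process of intensity `1 / 2`. -/
theorem integral_yuleProb_mul_exp_neg {m : ℕ} (hm : 1 ≤ m) (k : ℕ) :
    ∫ x in Set.Ioi 0, yuleProb (1 / 2) m k x * Real.exp (-x) = limitLaw m k := by
  induction k using Nat.strong_induction_on with
  | _ k ih =>
  have hhalf : (0 : ℝ) < 1 / 2 := by norm_num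
  have hparts := yuleProb_zero_add_integral hhalf hm k
  have hi1 := integrableOn_mul_exp_neg (continuous_birthFlux_yuleProb (1 / 2) hm k)
    (integrableOn_birthFlux_yuleProb hhalf hm k)
  have hi2 := integrableOn_mul_exp_neg (continuous_yuleProb (1 / 2) hm k)
    (integrableOn_yuleProb hhalf hm k)
  have hderiv : ∫ x in Set.Ioi 0, yuleProbDeriv (1 / 2) m k x * Real.exp (-x) =
      (∫ x in Set.Ioi 0, birthFlux (fun l => yuleProb (1 / 2) m l x) k * Real.exp (-x)) / 2 -
        k / 2 * ∫ x in Set.Ioi 0, yuleProb (1 / 2) m k x * Real.exp (-x) := by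
    rw [← integral_div, ← integral_const_mul, ← integral_sub (hi1.div_const _) (hi2.const_mul _)]
    refine integral_congr_ae (ae_of_all _ fun x => ?_)
    simp only [yuleProbDeriv]
    ring
  have hflux : ∫ x in Set.Ioi 0, birthFlux (fun l => yuleProb (1 / 2) m l x) k * Real.exp (-x) =
      birthFlux (limitLaw m) k := by
    cases k with
    | zero => simp [birthFlux]
    | succ k =>
      simp only [birthFlux, mul_assoc]
      rw [integral_const_mul, ih k (by omega)]
  -- With `I` the integral sought, the identity is now `1_{k = m} + birthFlux (limitLaw m) k / 2 - k
  -- / 2 * I = I`, the recursion of `limitLaw`.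
  rw [hderiv, hflux, yuleProb_zero] at hparts
  rw [limitLaw_eq hm, eq_div_iff (by positivity)]
  linarith

theorem IsYuleModel.tendsto_measureReal_genusSize {Ω : Type*} [MeasurableSpace Ω] {Q : Measure Ω}
    [IsProbabilityMeasure Q] {m : ℕ} {N : ℝ≥0 → Ω → ℕ} {X : ℕ → ℝ≥0 → Ω → ℕ}
    (hY : IsYuleModel Q m (1 / 2) 1 N X) (hm : 1 ≤ m) {J : ℝ≥0 → Ω → ℕ}
    (hJ : IsUniformGenus Q N X J) (k : ℕ) :
    Tendsto (fun T : ℝ≥0 => Q.real {ω | genusSize N X T (J T ω) ω = k}) atTop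
      (𝓝 (limitLaw m k)) := by
  have hhalf : (0 : ℝ) < 1 / 2 := by norm_num
  simp only [hY.measureReal_genusSize_eq_integral hm hJ]
  rw [← integral_yuleProb_mul_exp_neg hm, ← yuleProb_zero_add_integral hhalf hm]
  exact hY.tendsto_integral_genusAge hJ (hasDerivAt_yuleProb (1 / 2) hm k)
    (continuous_yuleProbDeriv (1 / 2) hm k) (integrableOn_yuleProbDeriv hhalf hm k)

/-! ### The main theorem. -/

theorem theorem2 {Ω Ω' : Type*} [MeasurableSpace Ω] [MeasurableSpace Ω']
    (P : Measure Ω) [IsProbabilityMeasure P] (Q : Measure Ω') [IsProbabilityMeasure Q]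
    (m : ℕ) (hm : 1 ≤ m)
    (G : ℕ → Ω → MultiGraph) (hG : IsBAProcess P m G)
    (V : ℕ → Ω → ℕ) (hV : IsUniformVertex P G V)
    (N : ℝ≥0 → Ω' → ℕ) (X : ℕ → ℝ≥0 → Ω' → ℕ) (hY : IsYuleModel Q m (1 / 2) 1 N X)
    (J : ℝ≥0 → Ω' → ℕ) (hJ : IsUniformGenus Q N X J) :
    ∃ p : ℕ → ℝ,
      (∀ k : ℕ, m ≤ k →
        Tendsto (fun n : ℕ =>
            P.real {ω | (G (n * (m + 1)) ω).degree (V (n * (m + 1)) ω) = k})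
          atTop (𝓝 (p k)) ∧
        Tendsto (fun T : ℝ≥0 => Q.real {ω | genusSize N X T (J T ω) ω = k})
          atTop (𝓝 (p k))) ∧
      (∀ C : ℝ, (m : ℝ) * √8 < C →
        Tendsto (fun n : ℕ =>
            P.real {ω | C * √(((m : ℝ) + 1) * Real.log ((n : ℝ) * ((m : ℝ) + 1)) / (n : ℝ)) ≤
              ⨆ k : ℕ, |((G (n * (m + 1)) ω).degreeCount k : ℝ) / (n : ℝ) -
                P.real {ω' | (G (n * (m + 1)) ω').degree (V (n * (m + 1)) ω') = k}|})
          atTop (𝓝 0)) ∧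
      (∀ k : ℕ, m ≤ k →
        TendstoInMeasure P
          (fun (n : ℕ) (ω : Ω) => ((G (n * (m + 1)) ω).degreeCount k : ℝ) / (n : ℝ))
          atTop (fun _ => p k)) := by

  have hVlim : ∀ k, Tendsto (fun n : ℕ =>
      P.real {ω | (G (n * (m + 1)) ω).degree (V (n * (m + 1)) ω) = k}) atTop
      (𝓝 (limitLaw m k)) := by
    intro k
    refine (hG.tendsto_integral_degreeCount_div hm k).congr' ?_
    filter_upwards [eventually_ge_atTop 1] with n hn
    obtain ⟨n, rfl⟩ : ∃ n', n = n' + 1 := ⟨n - 1, by omega⟩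
    exact (hG.measureReal_degree_uniformVertex hV k n).symm
  exact ⟨limitLaw m, fun k _ => ⟨hVlim k, hY.tendsto_measureReal_genusSize hm hJ k⟩,
    fun C hC => hG.tendsto_measureReal_iSup_ge hm hV hC,
    fun k _ => hG.tendstoInMeasure_degreeCount_div hm k⟩
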